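/- Let $q\ge 1$ be an integer, let $\chi$ be an even primitive Dirichlet character modulo $q$ (for $q=1$, the trivial character), let $N$ be an odd positive integer and let $x>0$ be real. Then all the infinite series below converge absolutely, and $$\sum_{r=1}^{q}\sum_{n=1}^{\infty}\frac{\chi(r)}{n}\,\frac{\exp\left(-\frac{r}{q}n^N x\right)}{1-\exp(-n^N x)}=\mathcal R_0+\mathcal R_1+\mathcal R(N)+\mathcal K_{\chi,N}(x),$$ where $$\mathcal R_0=\begin{cases}\dfrac{1}{2N}\left(\gamma(1-N)-\log(2\pi)+\log x\right), & q=1,\\[2mm] -\dfrac{1}{2N}\displaystyle\sum_{r=1}^{q-1}\chi(r)\log\left(\sin\left(\frac{r\pi}{q}\right)\right), & q>1,\end{cases}$$ $$\mathcal R_1=\begin{cases}\dfrac{\zeta(N+1)}{x}, & q=1,\\ 0, & q>1,\end{cases}\qquad \mathcal R(N)=\begin{cases}\dfrac{x}{2q}L(-1,\chi), & N=1,\\ 0, & N>1,\end{cases}$$ and $$\mathcal K_{\chi,N}(x)=(-1)^{\frac{N+3}{2}}\frac{\mathcal G(\chi)}{N}\sum_{n=1}^{\infty}\frac{\overline{\chi}(n)}{n}\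 \sum_{j}\frac{\exp\left(\frac{i\pi j}{2}\right)}{\exp\left(2\pi\left(\frac{2\pi n}{x}\right)^{1/N}\exp\left(-\frac{i\pi j}{2N}\right)\right)-1},$$ the inner sum being over $j=-(N-1),-(N-3),\dots,N-3,N-1$. Here $\gamma$ is Euler's constant, $\zeta$ is the Riemann zeta function, $L(s,\chi)$ is the analytically continued Dirichlet $L$-function of $\chi$, $\overline{\chi}$ is the complex conjugate character, and $\mathcal G(\chi)=\sum_{r=1}^{q}\chi(r)e^{2\pi i r/q}$ is the Gauss sum. -/

import Mathlib

noncomputable section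

namespace LambertChar

/-- The double-primed sum `∑''_{j = -(N-1)}^{N-1} f j`, in which `j` runs through
`-(N-1), -(N-3), …, N-3, N-1`, that is, `j = 2k - (N-1)` for `0 ≤ k < N`. -/
def doublePrimeSum (N : ℕ) (f : ℤ → ℂ) : ℂ :=
  ∑ k ∈ Finset.range N, f (2 * (k : ℤ) - ((N : ℤ) - 1))

/-- The term `(χ(r) / n) * exp(-(r/q) n^N x) / (1 - exp(-n^N x))` of the Lambert series. -/
def lambertTerm {q : ℕ} (χ : DirichletCharacter ℂ q) (N : ℕ) (x : ℝ) (r n : ℕ) : ℂ :=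
  χ (r : ZMod q) / (n : ℂ) *
    ((Real.exp (-((r : ℝ) / (q : ℝ)) * (n : ℝ) ^ N * x) /
      (1 - Real.exp (-(n : ℝ) ^ N * x)) : ℝ) : ℂ)

/-- The contribution of the residue at `0` (for an even primitive character). -/
def R0 {q : ℕ} (χ : DirichletCharacter ℂ q) (N : ℕ) (x : ℝ) : ℂ :=
  if q = 1 then
    ((1 / (2 * (N : ℝ)) * (Real.eulerMascheroniConstant * (1 - (N : ℝ))
      - Real.log (2 * Real.pi) + Real.log x) : ℝ) : ℂ)
  else
    -(1 / (2 * (N : ℂ))) * ∑ r ∈ Finset.Icc 1 (q - 1),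
      χ (r : ZMod q) * (Real.log (Real.sin ((r : ℝ) * Real.pi / (q : ℝ))) : ℂ)

/-- The term `ζ(N+1)/x`, present only for `q = 1`. -/
def R1 (q N : ℕ) (x : ℝ) : ℂ :=
  if q = 1 then riemannZeta ((N : ℂ) + 1) / (x : ℂ) else 0

/-- The term `(x / 2q) L(-1, χ)`, present only for `N = 1`; `L(s, χ)` is the analytically
continued Dirichlet `L`-function. -/
def RN {q : ℕ} [NeZero q] (χ : DirichletCharacter ℂ q) (N : ℕ) (x : ℝ) : ℂ :=
  if N = 1 then (x : ℂ) / (2 * (q : ℂ)) * DirichletCharacter.LFunction χ (-1) else 0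

/-- The Gauss sum `∑_{r=1}^{q} χ(r) exp(2πir/q)`. -/
def gauss {q : ℕ} (χ : DirichletCharacter ℂ q) : ℂ :=
  ∑ r ∈ Finset.Icc 1 q, χ (r : ZMod q) *
    Complex.exp (2 * (Real.pi : ℂ) * Complex.I * (r : ℂ) / (q : ℂ))

/-- The `n`-th term of the dual series: `conj(χ(n)) / n` times the double-primed sum over `j` of
`exp(iπj/2) / (exp(2π (2πn/x)^(1/N) exp(-iπj/(2N))) - 1)`. -/
def dualTerm {q : ℕ} (χ : DirichletCharacter ℂ q) (N : ℕ) (x : ℝ) (n : ℕ) : ℂ :=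
  (starRingEnd ℂ) (χ (n : ZMod q)) / (n : ℂ) *
    doublePrimeSum N fun j : ℤ =>
      Complex.exp (Complex.I * (Real.pi : ℂ) * (j : ℂ) / 2) /
        (Complex.exp (2 * (Real.pi : ℂ) *
            (((2 * Real.pi * (n : ℝ) / x) ^ (1 / (N : ℝ)) : ℝ) : ℂ) *
            Complex.exp (-(Complex.I * (Real.pi : ℂ) * (j : ℂ)) / (2 * (N : ℂ)))) - 1)

/-- The dual series `K_{χ,N}(x)`, meant for odd `N` (then `N + 3` is even). -/
def K {q : ℕ} (χ : DirichletCharacter ℂ q) (N : ℕ) (x : ℝ) : ℂ :=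
  (-1) ^ ((N + 3) / 2) * (gauss χ / (N : ℂ)) * ∑' n : ℕ+, dualTerm χ N x (n : ℕ)

end LambertChar

end

/-! For `0 ≤ a ≤ 1` the kernel `(exp (-a y) + exp (-(1 - a) y)) / (1 - exp (-y))` extends to a
continuous `1`-periodic function of `a`, whose Fourier coefficients are the Poisson kernels
`2 y / (y ^ 2 + 4 π ^ 2 m ^ 2)`. Put `y = n ^ N x`, divide by `n` and sum over `n` first: partial
fractions in `n ^ 2` and the expansion of the hyperbolic cotangent evaluate the `m`-th coefficient
as a term of the dual series plus `1 / (2 N m)`, and, only for `N = 1`, a multiple of `1 / m ^ 2`.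
Summed over `m` against `cos (2 π m a)`, the terms `1 / (2 N m)` give `-log (2 sin (π a)) / (2 N)`;
summed against `χ`, the cosines become Gauss sums and the terms `1 / m ^ 2` give `L (-1, χ)` by the
functional equation.

The interchange of the two summations is by dominated convergence, through the bound `C / y` for
the partial sums over `m`. At `a = 1`, the only case for `q = 1`, the series over `m` of
`1 / (2 N m)` diverges and the partial sums are no longer bounded by `C / y`; there one first
subtracts the integral of the Poisson kernel, an arctangent, whose sum over `n` supplies the terms
in `γ` and `log x`.
-/

section PartialFractions

open Lagrange Polynomial

variable {F : Type*} [Field F] {n h : ℕ} {ζ α a : F}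

theorem injOn_pow_mul (hζ : IsPrimitiveRoot ζ n) (hα : α ≠ 0) :
    Set.InjOn (fun k : ℕ => ζ ^ k * α) (Finset.range n) := fun _ hi _ hj hij =>
  hζ.pow_inj (Finset.mem_range.mp hi) (Finset.mem_range.mp hj) (mul_right_cancel₀ hα hij)

theorem nodal_pow_mul (hζ : IsPrimitiveRoot ζ n) (hn : 0 < n) (hα : α ^ n = a) :
    nodal (Finset.range n) (fun k => ζ ^ k * α) = X ^ n - C a :=
  (X_pow_sub_C_eq_prod hζ hn hα).symm

theorem pow_mul_pow_eq_of_pow_eq (hζ : IsPrimitiveRoot ζ n) (hα : α ^ n = a) (k : ℕ) :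
    (ζ ^ k * α) ^ n = a := by
  rw [mul_pow, hα, pow_right_comm, hζ.pow_eq_one, one_pow, one_mul]

theorem nodalWeight_pow_mul (hζ : IsPrimitiveRoot ζ n) (hα : α ^ n = a) (ha : a ≠ 0) {k : ℕ}
    (hk : k ∈ Finset.range n) :
    nodalWeight (Finset.range n) (fun k => ζ ^ k * α) k = ζ ^ k * α / (n * a) := by
  have hn : 0 < n := (Nat.zero_le k).trans_lt (Finset.mem_range.mp hk)
  have hnode := pow_mul_pow_eq_of_pow_eq hζ hα k
  have hne : ζ ^ k * α ≠ 0 := (pow_ne_zero_iff hn.ne').mp (hnode.trans_ne ha)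
  rw [nodalWeight_eq_eval_derivative_nodal hk, nodal_pow_mul hζ hn hα, inv_eq_iff_eq_inv, inv_div]
  simp only [derivative_sub, derivative_X_pow, derivative_C, sub_zero, eval_mul, eval_pow,
    eval_X, map_natCast, eval_natCast]
  rw [eq_div_iff hne, mul_assoc, ← pow_succ, Nat.sub_add_cancel hn, hnode]

theorem pow_div_pow_sub_eq_sum (hζ : IsPrimitiveRoot ζ n) (hh : h < n) (hα : α ^ n = a)
    (ha : a ≠ 0) {v : F} (hv : v ^ n ≠ a) :
    v ^ h / (v ^ n - a) =
      1 / (n * a) * ∑ k ∈ Finset.range n, (ζ ^ k * α) ^ (h + 1) / (v - ζ ^ k * α) := by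
  have hn : 0 < n := (Nat.zero_le h).trans_lt hh
  have hα0 : α ≠ 0 := (pow_ne_zero_iff hn.ne').mp (hα.trans_ne ha)
  have hX : (X : F[X]) ^ h = interpolate (Finset.range n) (fun k => ζ ^ k * α)
      fun k => (ζ ^ k * α) ^ h :=
    eq_interpolate_of_eval_eq _ (injOn_pow_mul hζ hα0) (by simpa [degree_X_pow] using hh) (by simp)
  have heval := congrArg (eval v) hX
  rw [eval_interpolate_not_at_node _ fun k _ hk => hv (by rw [hk, pow_mul_pow_eq_of_pow_eq hζ hα]),
    nodal_pow_mul hζ hn hα] at heval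
  simp only [eval_pow, eval_X, eval_sub, eval_C] at heval
  rw [heval, mul_div_cancel_left₀ _ (sub_ne_zero.mpr hv), Finset.mul_sum]
  refine Finset.sum_congr rfl fun k hk => ?_
  rw [nodalWeight_pow_mul hζ hα ha hk, pow_succ]
  simp only [div_eq_mul_inv, one_mul]
  ring

end PartialFractions

noncomputable section

namespace LambertChar

open Filter Topology
open scoped Real

section ClosedForm

open Complex

theorem hasSum_div_sq_add_sq {a : ℂ} (ha : 0 < a.re) :
    HasSum (fun n : ℕ => a / (((n : ℂ) + 1) ^ 2 + a ^ 2))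
      (π / 2 + π / (exp (2 * π * a) - 1) - 1 / (2 * a)) := by
  have ha0 : a ≠ 0 := by rintro rfl; simp at ha
  have hmem : a * I ∈ integerComplement :=
    UpperHalfPlane.coe_mem_integerComplement ⟨a * I, by simpa using ha⟩
  have hexp : exp (2 * π * I * (a * I)) = (exp (2 * π * a))⁻¹ := by
    rw [← exp_neg]
    congr 1
    linear_combination 2 * π * a * I_sq
  have hE : exp (2 * π * a) - 1 ≠ 0 := by
    refine sub_ne_zero.mpr fun h => ?_
    have := congrArg norm h
    rw [norm_exp, norm_one, Real.exp_eq_one_iff] at this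
    simp [ha.ne', Real.pi_ne_zero] at this
  have hcot := (summable_cotTerm hmem).hasSum.mul_left (-1 / (2 * I))
  rw [show (∑' n, cotTerm (a * I) n) = _ from (cot_series_rep' hmem).symm,
    cot_pi_eq_exp_ratio, hexp] at hcot
  convert! hcot using 1
  · ext n
    have hprod : (a * I + (n + 1)) * (a * I - (n + 1)) = -(((n : ℂ) + 1) ^ 2 + a ^ 2) := by
      linear_combination a ^ 2 * I_sq
    rw [cotTerm_identity hmem, hprod]
    field_simp
  · have hE0 := exp_ne_zero (2 * π * a)
    generalize exp (2 * π * a) = E at *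
    have hinv : 1 - E⁻¹ = (E - 1) / E := by field_simp
    rw [hinv]
    field_simp
    linear_combination (1 + π * a + π * a * E - E) * I_sq

theorem hasSum_doublePrimeSum {N : ℕ} {f : ℤ → ℕ → ℂ} {g : ℤ → ℂ}
    (hf : ∀ j : ℤ, |j| < N → HasSum (f j) (g j)) :
    HasSum (fun n => doublePrimeSum N fun j => f j n) (doublePrimeSum N g) :=
  hasSum_sum fun k hk => hf _ (abs_lt.mpr (by have := Finset.mem_range.mp hk; lia))

theorem norm_doublePrimeSum_le {N : ℕ} {f : ℤ → ℂ} {g : ℤ → ℝ}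
    (hf : ∀ j : ℤ, |j| < N → ‖f j‖ ≤ g j) :
    ‖doublePrimeSum N f‖ ≤ ∑ k ∈ Finset.range N, g (2 * (k : ℤ) - ((N : ℤ) - 1)) :=
  norm_sum_le_of_le _ fun k hk => hf _ (abs_lt.mpr (by have := Finset.mem_range.mp hk; lia))

/-- The root `T ^ (1 / N) * exp (-iπj / (2N))` of `z ^ (2 N) = T ^ 2` (for even `j`). For odd `N`,
as `j` runs through `-(N - 1), -(N - 3), …, N - 1` these are the roots in the right half-plane. -/
def dualRoot (N : ℕ) (T : ℝ) (j : ℤ) : ℂ :=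
  ((T ^ (1 / (N : ℝ)) : ℝ) : ℂ) * exp (-(I * (π : ℂ) * (j : ℂ)) / (2 * (N : ℂ)))

/-- The inner sum of the dual series, as a function of `T = 2πn / x`. -/
def dualSum (N : ℕ) (T : ℝ) : ℂ :=
  doublePrimeSum N fun j => exp (I * π * j / 2) / (exp (2 * π * dualRoot N T j) - 1)

theorem dualTerm_eq {q : ℕ} (χ : DirichletCharacter ℂ q) (N : ℕ) (x : ℝ) (n : ℕ) :
    dualTerm χ N x n = starRingEnd ℂ (χ n) / n * dualSum N (2 * π * n / x) := by
  simp only [dualTerm, dualSum, dualRoot, mul_assoc]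

theorem dualRoot_pow {N : ℕ} (hN : N ≠ 0) {T : ℝ} (hT : 0 ≤ T) (j : ℤ) :
    dualRoot N T j ^ N = T * exp (-(I * π * j / 2)) := by
  have hNC : (N : ℂ) ≠ 0 := Nat.cast_ne_zero.mpr hN
  rw [dualRoot, mul_pow, ← ofReal_pow, one_div, Real.rpow_inv_natCast_pow hT hN, ← exp_nat_mul]
  congr 2
  field_simp

theorem dualRoot_sq {N : ℕ} (hN : N ≠ 0) (T : ℝ) (k : ℕ) :
    dualRoot N T (2 * k - (N - 1)) ^ 2 =
      (exp (2 * π * I / N))⁻¹ ^ k * dualRoot N T (-(N - 1)) ^ 2 := by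
  have hNC : (N : ℂ) ≠ 0 := Nat.cast_ne_zero.mpr hN
  rw [dualRoot, dualRoot, mul_pow, mul_pow, ← exp_neg, ← exp_nat_mul, ← exp_nat_mul,
    ← exp_nat_mul, mul_left_comm, ← exp_add]
  congr 2
  push_cast
  field_simp
  ring

theorem re_dualRoot (N : ℕ) (T : ℝ) (j : ℤ) :
    (dualRoot N T j).re = T ^ (1 / (N : ℝ)) * Real.cos (π * j / (2 * N)) := by
  have harg : -(I * π * j) / (2 * N) = ((-(π * j / (2 * N)) : ℝ) : ℂ) * I := by push_cast; ring
  rw [dualRoot, harg, re_ofReal_mul, exp_ofReal_mul_I_re, Real.cos_neg]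

theorem cos_pi_mul_div_pos {N : ℕ} {j : ℤ} (hj : |j| < N) :
    0 < Real.cos (π * j / (2 * N)) := by
  have hj' : |(j : ℝ)| < N := by exact_mod_cast hj
  obtain ⟨h₁, h₂⟩ := abs_lt.mp hj'
  have hN : (0 : ℝ) < N := (abs_nonneg _).trans_lt hj'
  have hpi := Real.pi_pos
  refine Real.cos_pos_of_mem_Ioo ⟨?_, ?_⟩
  · rw [lt_div_iff₀ (by positivity)]; nlinarith
  · rw [div_lt_iff₀ (by positivity)]; nlinarith

theorem re_dualRoot_pos {N : ℕ} {T : ℝ} (hT : 0 < T) {j : ℤ} (hj : |j| < N) :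
    0 < (dualRoot N T j).re := by
  rw [re_dualRoot]
  exact mul_pos (Real.rpow_pos_of_pos hT _) (cos_pi_mul_div_pos hj)

theorem exp_I_mul_pi_mul_even_div_two (h k : ℕ) :
    exp (I * π * (2 * (k : ℤ) - ((2 * h + 1 : ℕ) - 1) : ℤ) / 2) = (-1) ^ k * (-1) ^ h := by
  have harg : I * (π : ℂ) * (2 * (k : ℤ) - ((2 * h + 1 : ℕ) - 1) : ℤ) / 2 =
      k * (π * I) - h * (π * I) := by push_cast; ring
  rw [harg, exp_sub, exp_nat_mul, exp_nat_mul, exp_pi_mul_I, div_eq_mul_inv, ← inv_pow,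
    inv_neg_one]

theorem doublePrimeSum_exp_I_mul_pi_div_two (h : ℕ) :
    doublePrimeSum (2 * h + 1) (fun j => exp (I * π * j / 2)) = (-1) ^ h := by
  simp only [doublePrimeSum, exp_I_mul_pi_mul_even_div_two]
  rw [← Finset.sum_mul, geom_sum_eq (by norm_num), Odd.neg_one_pow ⟨h, rfl⟩]
  norm_num

theorem pow_div_pow_add_sq_eq_doublePrimeSum (h : ℕ) {T : ℝ} (hT : 0 < T) {v : ℂ}
    (hv : v ^ (2 * h + 1) + (T : ℂ) ^ 2 ≠ 0) :
    v ^ h / (v ^ (2 * h + 1) + (T : ℂ) ^ 2) =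
      (-1) ^ h / ((2 * h + 1 : ℕ) * T) * doublePrimeSum (2 * h + 1) fun j =>
        exp (I * π * j / 2) * dualRoot (2 * h + 1) T j / (v + dualRoot (2 * h + 1) T j ^ 2) := by
  set N := 2 * h + 1 with hN
  have hN0 : N ≠ 0 := by lia
  have hNC : (N : ℂ) ≠ 0 := Nat.cast_ne_zero.mpr hN0
  have hTC : (T : ℂ) ≠ 0 := ofReal_ne_zero.mpr hT.ne'
  have hsign (k : ℕ) := exp_I_mul_pi_mul_even_div_two h k
  rw [← hN] at hsign
  have hsq (n : ℕ) : ((-1 : ℂ) ^ n) * (-1) ^ n = 1 := by rw [← mul_pow]; simp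
  have hpow (k : ℕ) : dualRoot N T (2 * k - (N - 1)) ^ N = T * ((-1) ^ k * (-1) ^ h) := by
    rw [dualRoot_pow hN0 hT.le, exp_neg, hsign, mul_inv, ← inv_pow, ← inv_pow, inv_neg_one]
  have hroot (k : ℕ) : (exp (2 * π * I / N))⁻¹ ^ k * -dualRoot N T (-(N - 1)) ^ 2 =
      -dualRoot N T (2 * k - (N - 1)) ^ 2 := by
    rw [dualRoot_sq hN0, mul_neg]
  have hα : (-dualRoot N T (-(N - 1)) ^ 2) ^ N = -(T : ℂ) ^ 2 := by
    have h0 := hpow 0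
    rw [Nat.cast_zero, mul_zero, zero_sub, pow_zero, one_mul] at h0
    rw [Odd.neg_pow ⟨h, hN⟩, pow_right_comm, h0, mul_pow, sq ((-1) ^ h), hsq, mul_one]
  rw [← sub_neg_eq_add, pow_div_pow_sub_eq_sum (isPrimitiveRoot_exp N hN0).inv (by lia) hα
    (neg_ne_zero.mpr (pow_ne_zero 2 hTC)) (fun hv' => hv (by rw [hv', neg_add_cancel])),
    doublePrimeSum, Finset.mul_sum, Finset.mul_sum]
  refine Finset.sum_congr rfl fun k _ => ?_
  have hnum : (dualRoot N T (2 * k - (N - 1)) ^ 2) ^ (h + 1) =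
      T * ((-1) ^ k * (-1) ^ h) * dualRoot N T (2 * k - (N - 1)) := by
    rw [← hpow, ← pow_succ, ← pow_mul]; congr 1
  rw [hroot, hsign, neg_pow, hnum, sub_neg_eq_add]
  field_simp
  ring

theorem doublePrimeSum_exp_div_dualRoot (h : ℕ) {T : ℝ} (hT : 0 < T) :
    doublePrimeSum (2 * h + 1) (fun j => exp (I * π * j / 2) / dualRoot (2 * h + 1) T j) =
      if h = 0 then 1 / (T : ℂ) else 0 := by
  have hTC : (T : ℂ) ≠ 0 := ofReal_ne_zero.mpr hT.ne'
  have hzero := pow_div_pow_add_sq_eq_doublePrimeSum h hT (v := 0) (by simpa using hTC)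
  have hdiv (z w : ℂ) : z * w / (0 + w ^ 2) = z / w := by
    rcases eq_or_ne w 0 with rfl | hw
    · simp
    · rw [zero_add]; field_simp
  simp only [hdiv] at hzero
  rcases eq_or_ne h 0 with rfl | hh
  · rw [if_pos rfl]
    have hT2 : (0 : ℂ) ^ (2 * 0 + 1) + T ^ 2 = T ^ 2 := by ring
    rw [hT2] at hzero
    field_simp at hzero ⊢
    simpa using hzero.symm
  · rw [zero_pow hh, zero_div, eq_comm] at hzero
    rw [if_neg hh]
    refine (mul_eq_zero.mp hzero).resolve_left ?_
    have : ((2 * h + 1 : ℕ) : ℂ) ≠ 0 := Nat.cast_ne_zero.mpr (by lia)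
    exact div_ne_zero (pow_ne_zero _ (by norm_num)) (mul_ne_zero this hTC)

/-- Only for `N = 1` does the pole of the hyperbolic cotangent at `0` leave a trace. -/
theorem hasSum_pow_div_pow_add_sq (h : ℕ) {T : ℝ} (hT : 0 < T) :
    HasSum (fun n : ℕ => ((n : ℂ) + 1) ^ (2 * h) / (((n : ℂ) + 1) ^ (2 * (2 * h + 1)) + T ^ 2))
      (π / (2 * (2 * h + 1 : ℕ) * T) +
        (-1) ^ h * (π / ((2 * h + 1 : ℕ) * T)) * dualSum (2 * h + 1) T -
        if h = 0 then 1 / (2 * T ^ 2 : ℂ) else 0) := by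
  have hsq : ((-1 : ℂ) ^ h) * (-1) ^ h = 1 := by rw [← mul_pow]; simp
  have hsum := (hasSum_doublePrimeSum fun j hj =>
    (hasSum_div_sq_add_sq (re_dualRoot_pos (N := 2 * h + 1) hT hj)).mul_left
      (exp (I * π * j / 2))).mul_left ((-1) ^ h / ((2 * h + 1 : ℕ) * T : ℂ))
  convert! hsum using 1
  · ext n
    rw [pow_mul, pow_mul ((n : ℂ) + 1) 2, pow_div_pow_add_sq_eq_doublePrimeSum h hT]
    · simp only [mul_div_assoc]
    · have : ((((n : ℝ) + 1) ^ 2) ^ (2 * h + 1) + T ^ 2 : ℝ) ≠ 0 := by positivity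
      exact_mod_cast this
  · have hsplit : doublePrimeSum (2 * h + 1) (fun j => exp (I * π * j / 2) * (π / 2 +
        π / (exp (2 * π * dualRoot (2 * h + 1) T j) - 1) - 1 / (2 * dualRoot (2 * h + 1) T j))) =
        π / 2 * (-1) ^ h + π * dualSum (2 * h + 1) T -
          1 / 2 * if h = 0 then 1 / (T : ℂ) else 0 := by
      rw [← doublePrimeSum_exp_I_mul_pi_div_two, ← doublePrimeSum_exp_div_dualRoot h hT]
      simp only [dualSum, doublePrimeSum, Finset.mul_sum, ← Finset.sum_add_distrib,
        ← Finset.sum_sub_distrib]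
      refine Finset.sum_congr rfl fun k _ => ?_
      ring
    rw [hsplit]
    split_ifs with hh
    · subst hh
      have hTC : (T : ℂ) ≠ 0 := ofReal_ne_zero.mpr hT.ne'
      push_cast
      field_simp
    · linear_combination (-π / (2 * (2 * h + 1 : ℕ) * T : ℂ)) * hsq

theorem exists_norm_dualSum_le (N : ℕ) :
    ∃ C, ∀ T : ℝ, 0 < T → ‖dualSum N T‖ ≤ C * T ^ (-(1 / (N : ℝ))) := by
  refine ⟨∑ k ∈ Finset.range N,
    1 / (2 * π * Real.cos (π * (2 * (k : ℤ) - ((N : ℤ) - 1) : ℤ) / (2 * N))), fun T hT => ?_⟩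
  rw [Finset.sum_mul]
  refine norm_doublePrimeSum_le (g := fun j =>
    1 / (2 * π * Real.cos (π * j / (2 * N))) * T ^ (-(1 / (N : ℝ)))) fun j hj => ?_
  have hre := re_dualRoot_pos hT hj
  have hnum : ‖exp (I * π * j / 2)‖ = 1 := by
    rw [show I * (π : ℂ) * j / 2 = ((π * j / 2 : ℝ) : ℂ) * I by push_cast; ring,
      norm_exp_ofReal_mul_I]
  have hden : 2 * π * (dualRoot N T j).re ≤ ‖exp (2 * π * dualRoot N T j) - 1‖ := by
    calc 2 * π * (dualRoot N T j).re ≤ Real.exp (2 * π * (dualRoot N T j).re) - 1 :=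
          le_sub_iff_add_le.mpr (Real.add_one_le_exp _)
      _ = ‖exp (2 * π * dualRoot N T j)‖ - ‖(1 : ℂ)‖ := by
          rw [norm_exp, norm_one, ← ofReal_ofNat, ← ofReal_mul, re_ofReal_mul]
      _ ≤ ‖exp (2 * π * dualRoot N T j) - 1‖ := norm_sub_norm_le _ _
  calc ‖exp (I * π * j / 2) / (exp (2 * π * dualRoot N T j) - 1)‖
      ≤ 1 / (2 * π * (dualRoot N T j).re) := by
        rw [norm_div, hnum]
        exact one_div_le_one_div_of_le (by positivity) hden
    _ = _ := by
        rw [re_dualRoot, Real.rpow_neg hT.le]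
        ring

end ClosedForm

section PoissonKernel

/-- The Lambert series kernel `exp (-a y) / (1 - exp (-y))`. -/
def lambertKernel (a y : ℝ) : ℝ :=
  Real.exp (-a * y) / (1 - Real.exp (-y))

/-- The Fourier transform at `t` of `u ↦ exp (-y |u|)`. -/
def poissonKernel (y t : ℝ) : ℝ :=
  2 * y / (y ^ 2 + 4 * π ^ 2 * t ^ 2)

theorem poissonKernel_nonneg {y : ℝ} (hy : 0 ≤ y) (t : ℝ) : 0 ≤ poissonKernel y t := by
  unfold poissonKernel
  positivity

theorem poissonKernel_zero (y : ℝ) : poissonKernel y 0 = 2 / y := by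
  unfold poissonKernel
  rcases eq_or_ne y 0 with rfl | hy
  · simp
  · field_simp
    ring

theorem antitoneOn_poissonKernel {y : ℝ} (hy : 0 < y) :
    AntitoneOn (poissonKernel y) (Set.Ici 0) := by
  intro s hs t _ hst
  have hs : 0 ≤ s := hs
  unfold poissonKernel
  gcongr

theorem one_sub_exp_neg_pos {y : ℝ} (hy : 0 < y) : 0 < 1 - Real.exp (-y) :=
  sub_pos.mpr (Real.exp_lt_one_iff.mpr (neg_lt_zero.mpr hy))

theorem summable_poissonKernel_natCast_add_one (y : ℝ) :
    Summable fun m : ℕ => poissonKernel y (m + 1) := by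
  have hsq : Summable fun m : ℕ => 1 / ((m : ℝ) + 1) ^ 2 := by
    exact_mod_cast (summable_nat_add_iff 1).mpr (Real.summable_one_div_nat_pow.mpr one_lt_two)
  refine Summable.of_norm_bounded (hsq.mul_left (2 * |y| / (4 * π ^ 2))) fun m => ?_
  rw [poissonKernel, norm_div, norm_mul, Real.norm_eq_abs y, Real.norm_ofNat,
    Real.norm_of_nonneg (by positivity), div_mul_div_comm, mul_one]
  gcongr
  exact le_add_of_nonneg_left (sq_nonneg y)

open Complex

theorem integral_exp_mul_lambertKernel {y : ℝ} (hy : 0 < y) (n : ℤ) :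
    ∫ t in (0 : ℝ)..1, exp (-2 * π * I * n * t) *
      ((lambertKernel t y + lambertKernel (1 - t) y : ℝ) : ℂ) = poissonKernel y n := by
  set p : ℂ := -2 * π * I * n - y with hp
  set r : ℂ := -2 * π * I * n + y with hr
  have hp0 : p ≠ 0 := fun h => hy.ne' (by simpa [hp] using congrArg re h)
  have hr0 : r ≠ 0 := fun h => hy.ne' (by simpa [hr] using congrArg re h)
  have hpr : (y : ℂ) ^ 2 + 4 * π ^ 2 * n ^ 2 = -(p * r) := by
    rw [hp, hr]
    linear_combination (4 * π ^ 2 * n ^ 2 : ℂ) * I_sq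
  have hE : (1 - exp (-y) : ℂ) ≠ 0 := by exact_mod_cast (one_sub_exp_neg_pos hy).ne'
  have hperiod : exp (-2 * π * I * n) = 1 := by
    rw [show (-2 * π * I * n : ℂ) = ((-n : ℤ) : ℂ) * (2 * π * I) by push_cast; ring]
    exact exp_int_mul_two_pi_mul_I _
  have hsplit (t : ℝ) : exp (-2 * π * I * n * t) *
      ((lambertKernel t y + lambertKernel (1 - t) y : ℝ) : ℂ) =
      (1 - exp (-y) : ℂ)⁻¹ * (exp (p * t) + exp (-y) * exp (r * t)) := by
    simp only [lambertKernel]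
    push_cast
    rw [← exp_add, ← add_div, mul_div_assoc', mul_add, ← exp_add, ← exp_add, div_eq_inv_mul]
    congr 3
    · rw [hp]; ring
    · rw [hr]; ring
  simp_rw [hsplit]
  rw [intervalIntegral.integral_const_mul, intervalIntegral.integral_add
    (Continuous.intervalIntegrable (by fun_prop) _ _)
    (Continuous.intervalIntegrable (by fun_prop) _ _),
    intervalIntegral.integral_const_mul, integral_exp_mul_complex hp0,
    integral_exp_mul_complex hr0, poissonKernel]
  push_cast
  have hy2 : (2 * y : ℂ) = r - p := by rw [hp, hr]; ring
  have hexp_p : exp (p * 1) = exp (-y) := by rw [mul_one, hp, exp_sub, hperiod, exp_neg, one_div]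
  have hexp_r : exp (-y) * exp (r * 1) = 1 := by
    rw [mul_one, hr, exp_add, hperiod, one_mul, ← exp_add, neg_add_cancel, exp_zero]
  rw [hpr, hy2, hexp_p, mul_zero, mul_zero, exp_zero, mul_div_assoc', mul_sub, hexp_r]
  generalize exp (-y : ℂ) = E at *
  field_simp
  ring

/-- The even `1`-periodic function equal to `lambertKernel t y + lambertKernel (1 - t) y` for
`0 ≤ t ≤ 1`, on the circle. -/
def periodicLambertKernel (y : ℝ) : C(AddCircle (1 : ℝ), ℂ) where
  toFun := AddCircle.liftIco 1 0 fun t => ((lambertKernel t y + lambertKernel (1 - t) y : ℝ) : ℂ)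
  continuous_toFun := by
    have : Fact ((0 : ℝ) < 1) := ⟨zero_lt_one⟩
    refine AddCircle.liftIco_zero_continuous ?_ ?_
    · simp [add_comm]
    · unfold lambertKernel
      fun_prop

theorem fourierCoeff_periodicLambertKernel [Fact ((0 : ℝ) < 1)] {y : ℝ} (hy : 0 < y) (n : ℤ) :
    fourierCoeff (periodicLambertKernel y) n = poissonKernel y n := by
  change fourierCoeff (AddCircle.liftIco 1 0 _) n = _
  rw [fourierCoeff_liftIco_eq, fourierCoeffOn_eq_integral, ← integral_exp_mul_lambertKernel hy n]
  simp only [zero_add, sub_zero, div_one, one_smul, fourier_coe_apply, smul_eq_mul]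
  refine intervalIntegral.integral_congr fun t _ => ?_
  simp only [ofReal_one, div_one]
  congr 2
  push_cast
  ring

theorem hasSum_poissonKernel_mul_cos {y : ℝ} (hy : 0 < y) {a : ℝ} (ha : a ∈ Set.Ico (0 : ℝ) 1) :
    HasSum (fun m : ℕ => poissonKernel y (m + 1) * (2 * Real.cos (2 * π * (m + 1) * a)))
      (lambertKernel a y + lambertKernel (1 - a) y - 2 / y) := by
  have : Fact ((0 : ℝ) < 1) := ⟨zero_lt_one⟩
  have hcoeff := fourierCoeff_periodicLambertKernel hy
  have hneg (t : ℝ) : poissonKernel y (-t) = poissonKernel y t := by simp [poissonKernel]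
  have hnat : Summable fun m : ℕ => poissonKernel y m :=
    (summable_nat_add_iff 1).mp (by exact_mod_cast summable_poissonKernel_natCast_add_one y)
  have hsummable : Summable (fourierCoeff (periodicLambertKernel y)) := by
    rw [funext hcoeff]
    exact summable_ofReal.mpr (Summable.of_nat_of_neg hnat (by simpa [hneg] using hnat))
  have hfourier := has_pointwise_sum_fourier_series_of_summable hsummable (a : AddCircle (1 : ℝ))
  have hvalue : periodicLambertKernel y a =
      ((lambertKernel a y + lambertKernel (1 - a) y : ℝ) : ℂ) :=
    AddCircle.liftIco_coe_apply
      (f := fun t : ℝ => ((lambertKernel t y + lambertKernel (1 - t) y : ℝ) : ℂ))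
      (by rwa [zero_add])
  have hfold := (hasSum_nat_add_iff' 1).mpr hfourier.nat_add_neg
  rw [hvalue] at hfold
  simp_rw [hcoeff] at hfold
  rw [← hasSum_ofReal]
  convert! hfold using 1
  · ext m
    simp only [fourier_coe_apply, smul_eq_mul, Int.cast_neg, Int.cast_natCast, hneg, ← mul_add]
    push_cast
    rw [two_cos]
    congr 3 <;> ring
  · simp [poissonKernel_zero]

end PoissonKernel

section CosineSeries

theorem norm_sum_smul_le_of_antitone {E : Type*} [NormedAddCommGroup E] [NormedSpace ℝ E]
    {f : ℕ → ℝ} {z : ℕ → E} {b : ℝ} (hf : Antitone f) (hf0 : ∀ m, 0 ≤ f m)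
    (hz : ∀ n, ‖∑ m ∈ Finset.range n, z m‖ ≤ b) (n : ℕ) :
    ‖∑ m ∈ Finset.range n, f m • z m‖ ≤ f 0 * b := by
  have hstep (m : ℕ) : ‖(f (m + 1) - f m) • ∑ i ∈ Finset.range (m + 1), z i‖ ≤
      (f m - f (m + 1)) * b := by
    rw [norm_smul, norm_sub_rev, Real.norm_of_nonneg (sub_nonneg.mpr (hf m.le_succ))]
    exact mul_le_mul_of_nonneg_left (hz _) (sub_nonneg.mpr (hf m.le_succ))
  rw [Finset.sum_range_by_parts]
  calc _ ≤ ‖f (n - 1) • ∑ m ∈ Finset.range n, z m‖ +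
        ∑ m ∈ Finset.range (n - 1), ‖(f (m + 1) - f m) • ∑ i ∈ Finset.range (m + 1), z i‖ :=
      (norm_sub_le _ _).trans (by gcongr; exact norm_sum_le _ _)
    _ ≤ f (n - 1) * b + ∑ m ∈ Finset.range (n - 1), (f m - f (m + 1)) * b := by
      rw [norm_smul, Real.norm_of_nonneg (hf0 _)]
      gcongr with m
      exacts [hf0 _, hz n, hstep m]
    _ = f 0 * b := by
      rw [← Finset.sum_mul, Finset.sum_range_sub']
      ring

open Complex

theorem norm_geom_sum_le {z : ℂ} (hz : ‖z‖ ≤ 1) (hz1 : z ≠ 1) (n : ℕ) :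
    ‖∑ i ∈ Finset.range n, z ^ i‖ ≤ 2 / ‖z - 1‖ := by
  rw [geom_sum_eq hz1, norm_div]
  gcongr
  calc ‖z ^ n - 1‖ ≤ ‖z ^ n‖ + ‖(1 : ℂ)‖ := norm_sub_le _ _
    _ ≤ 1 + 1 := by
      rw [norm_pow, norm_one]
      gcongr
      exact pow_le_one₀ (norm_nonneg _) hz
    _ = 2 := by norm_num

theorem one_sub_mem_slitPlane {z : ℂ} (hz : ‖z‖ ≤ 1) (hz1 : z ≠ 1) : 1 - z ∈ slitPlane := by
  refine mem_slitPlane_iff.mpr (or_iff_not_imp_right.mpr fun him => ?_)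
  have him : z.im = 0 := by simpa using him
  have hre : z.re ≠ 1 := fun h => hz1 (Complex.ext h him)
  simpa using lt_of_le_of_ne ((re_le_norm z).trans hz) hre

theorem tendsto_sum_pow_div {z : ℂ} (hz : ‖z‖ ≤ 1) (hz1 : z ≠ 1) :
    Tendsto (fun M => ∑ m ∈ Finset.range M, z ^ m / m) atTop (𝓝 (-log (1 - z))) := by
  obtain ⟨l, hl⟩ : ∃ l, Tendsto (fun M => ∑ m ∈ Finset.range M, z ^ m / m) atTop (𝓝 l) := by
    have hanti : Antitone fun m : ℕ => 1 / ((m : ℝ) + 1) := fun m n hmn =>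
      one_div_le_one_div_of_le (by positivity) (by gcongr)
    have hbound (n : ℕ) : ‖∑ m ∈ Finset.range n, z ^ (m + 1)‖ ≤ 2 / ‖z - 1‖ := by
      simp_rw [pow_succ', ← Finset.mul_sum, norm_mul]
      exact (mul_le_of_le_one_left (norm_nonneg _) hz).trans (norm_geom_sum_le hz hz1 n)
    obtain ⟨l, hl⟩ := cauchySeq_tendsto_of_complete
      (hanti.cauchySeq_series_mul_of_tendsto_zero_of_bounded
        tendsto_one_div_add_atTop_nhds_zero_nat hbound)
    refine ⟨l, (tendsto_add_atTop_iff_nat 1).mp (hl.congr fun M => ?_)⟩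
    simp [Finset.sum_range_succ', div_eq_inv_mul]
  have habel := tendsto_tsum_powerSeries_nhdsWithin_lt hl
  rw [tendsto_map'_iff] at habel
  suffices Tendsto ((fun w => ∑' n : ℕ, z ^ n / n * w ^ n) ∘ ofReal) (𝓝[<] 1)
      (𝓝 (-log (1 - z))) by
    rwa [← tendsto_nhds_unique habel this]
  have hlog : Tendsto (fun r : ℝ => -log (1 - z * r)) (𝓝[<] 1) (𝓝 (-log (1 - z))) := by
    have hcont : ContinuousAt (fun r : ℝ => -log (1 - z * r)) 1 :=
      (ContinuousAt.clog (by fun_prop) (by simpa using one_sub_mem_slitPlane hz hz1)).neg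
    simpa using hcont.tendsto.mono_left nhdsWithin_le_nhds
  refine hlog.congr' ?_
  filter_upwards [Ioo_mem_nhdsLT zero_lt_one] with r hr
  have hnorm : ‖z * r‖ < 1 := by
    rw [norm_mul, norm_real, Real.norm_of_nonneg hr.1.le]
    exact (mul_le_of_le_one_left hr.1.le hz).trans_lt hr.2
  rw [← (hasSum_taylorSeries_neg_log hnorm).tsum_eq]
  exact tsum_congr fun n => by rw [mul_pow, mul_div_right_comm]

theorem sin_pi_mul_pos {a : ℝ} (ha : a ∈ Set.Ioo (0 : ℝ) 1) : 0 < Real.sin (π * a) :=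
  Real.sin_pos_of_pos_of_lt_pi (mul_pos Real.pi_pos ha.1) (mul_lt_of_lt_one_right Real.pi_pos ha.2)

theorem norm_exp_two_pi_mul_I_sub_one {a : ℝ} (ha : a ∈ Set.Ioo (0 : ℝ) 1) :
    ‖exp (I * (2 * π * a : ℝ)) - 1‖ = 2 * Real.sin (π * a) := by
  have hsin := sin_pi_mul_pos ha
  rw [norm_exp_I_mul_ofReal_sub_one, show 2 * π * a / 2 = π * a by ring,
    Real.norm_of_nonneg (by positivity)]

theorem re_exp_I_mul_pow (θ : ℝ) (m : ℕ) : (exp (I * θ) ^ m).re = Real.cos (m * θ) := by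
  rw [← exp_nat_mul, mul_left_comm, mul_comm I, ← ofReal_natCast, ← ofReal_mul,
    exp_ofReal_mul_I_re]

theorem exp_two_pi_mul_I_ne_one {a : ℝ} (ha : a ∈ Set.Ioo (0 : ℝ) 1) :
    exp (I * (2 * π * a : ℝ)) ≠ 1 := by
  rw [← sub_ne_zero, ← norm_ne_zero_iff, norm_exp_two_pi_mul_I_sub_one ha]
  exact (mul_pos two_pos (sin_pi_mul_pos ha)).ne'

theorem abs_sum_cos_le {a : ℝ} (ha : a ∈ Set.Ioo (0 : ℝ) 1) (n : ℕ) :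
    |∑ m ∈ Finset.range n, Real.cos (2 * π * (m + 1) * a)| ≤ 1 / Real.sin (π * a) := by
  set z := exp (I * (2 * π * a : ℝ)) with hz
  have hnorm : ‖z‖ = 1 := by rw [hz, mul_comm, norm_exp_ofReal_mul_I]
  have hre : ∑ m ∈ Finset.range n, Real.cos (2 * π * (m + 1) * a) =
      (z * ∑ m ∈ Finset.range n, z ^ m).re := by
    rw [Finset.mul_sum, re_sum]
    refine Finset.sum_congr rfl fun m _ => ?_
    rw [← pow_succ', re_exp_I_mul_pow]
    push_cast
    ring_nf
  calc _ ≤ ‖z * ∑ m ∈ Finset.range n, z ^ m‖ := hre ▸ abs_re_le_norm _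
    _ ≤ 2 / ‖z - 1‖ := by
      rw [norm_mul, hnorm, one_mul]
      exact norm_geom_sum_le hnorm.le (exp_two_pi_mul_I_ne_one ha) n
    _ = 1 / Real.sin (π * a) := by
      rw [hz, norm_exp_two_pi_mul_I_sub_one ha, div_mul_eq_div_div, div_self two_ne_zero]

theorem tendsto_sum_cos_div {a : ℝ} (ha : a ∈ Set.Ioo (0 : ℝ) 1) :
    Tendsto (fun M => ∑ m ∈ Finset.range M, Real.cos (2 * π * (m + 1) * a) / (m + 1)) atTop
      (𝓝 (-Real.log (2 * Real.sin (π * a)))) := by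
  set z := exp (I * (2 * π * a : ℝ)) with hz
  have hnorm : ‖z‖ = 1 := by rw [hz, mul_comm, norm_exp_ofReal_mul_I]
  have hlim := (continuous_re.tendsto _).comp
    (tendsto_sum_pow_div hnorm.le (exp_two_pi_mul_I_ne_one ha))
  rw [neg_re, log_re, norm_sub_rev, norm_exp_two_pi_mul_I_sub_one ha] at hlim
  refine (hlim.comp (tendsto_add_atTop_nat 1)).congr fun M => ?_
  simp only [Function.comp_apply, Finset.sum_range_succ', Nat.cast_zero, div_zero, add_zero, re_sum]
  refine Finset.sum_congr rfl fun m _ => ?_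
  rw [← ofReal_natCast, div_ofReal_re, re_exp_I_mul_pow]
  push_cast
  ring_nf

end CosineSeries

section DilationSum

/-- The sum of `g (n ^ N * x) / n` over `n ≥ 1`. Both the Lambert series and its dual series are
sums of this kind, for the kernels `lambertKernel a` and `(poissonKernel · t)`. -/
def dilationSum (N : ℕ) (x : ℝ) (g : ℝ → ℝ) : ℝ :=
  ∑' n : ℕ, g (((n : ℝ) + 1) ^ N * x) / (n + 1)

variable {N : ℕ} {x C : ℝ} {g : ℝ → ℝ}

theorem summable_one_div_add_one_pow_succ (hN : N ≠ 0) :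
    Summable fun n : ℕ => 1 / ((n : ℝ) + 1) ^ (N + 1) := by
  exact_mod_cast (summable_nat_add_iff 1).mpr
    (Real.summable_one_div_nat_pow.mpr (Nat.lt_add_of_pos_left (Nat.pos_of_ne_zero hN)))

theorem norm_dilation_le (hx : 0 < x) (hg : ∀ y > 0, |g y| ≤ C / y) (n : ℕ) :
    ‖g (((n : ℝ) + 1) ^ N * x) / (n + 1)‖ ≤ C / x * (1 / ((n : ℝ) + 1) ^ (N + 1)) := by
  rw [norm_div, Real.norm_of_nonneg (show 0 ≤ (n : ℝ) + 1 by positivity)]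
  calc _ ≤ C / (((n : ℝ) + 1) ^ N * x) / (n + 1) := by gcongr; exact hg _ (by positivity)
    _ = C / x * (1 / ((n : ℝ) + 1) ^ (N + 1)) := by
      rw [pow_succ]
      field_simp

theorem hasSum_dilationSum (hN : N ≠ 0) (hx : 0 < x) (hg : ∀ y > 0, |g y| ≤ C / y) :
    HasSum (fun n : ℕ => g (((n : ℝ) + 1) ^ N * x) / (n + 1)) (dilationSum N x g) :=
  (Summable.of_norm_bounded ((summable_one_div_add_one_pow_succ hN).mul_left _)
    (norm_dilation_le hx hg)).hasSum

theorem tendsto_dilationSum {u : ℕ → ℝ → ℝ} (hN : N ≠ 0) (hx : 0 < x)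
    (hu : ∀ M, ∀ y > 0, |u M y| ≤ C / y)
    (hlim : ∀ y > 0, Tendsto (fun M => u M y) atTop (𝓝 (g y))) :
    Tendsto (fun M => dilationSum N x (u M)) atTop (𝓝 (dilationSum N x g)) :=
  tendsto_tsum_of_dominated_convergence ((summable_one_div_add_one_pow_succ hN).mul_left (C / x))
    (fun _ => (hlim _ (by positivity)).div_const _)
    (.of_forall fun M => norm_dilation_le hx (hu M))

theorem hasSum_dilationSum_one_div (hN : N ≠ 0) (hx : 0 < x) :
    HasSum (fun n : ℕ => 1 / (((n : ℝ) + 1) ^ N * x) / (n + 1)) (dilationSum N x fun y => 1 / y) :=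
  hasSum_dilationSum hN hx (C := 1) fun _ hy => (abs_of_pos (one_div_pos.mpr hy)).le

theorem lambertKernel_nonneg {y : ℝ} (a : ℝ) (hy : 0 < y) : 0 ≤ lambertKernel a y :=
  div_nonneg (Real.exp_nonneg _) (one_sub_exp_neg_pos hy).le

theorem lambertKernel_le {a y : ℝ} (ha : 0 < a) (hy : 0 < y) :
    lambertKernel a y ≤ (1 + 1 / a) / y := by
  have hexp {b : ℝ} (hb : 0 < b) : Real.exp (-b) ≤ 1 / (1 + b) := by
    rw [Real.exp_neg, ← one_div, add_comm]
    exact one_div_le_one_div_of_le (by positivity) (Real.add_one_le_exp b)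
  have hden : y / (1 + y) ≤ 1 - Real.exp (-y) := by
    rw [le_sub_comm, one_sub_div (by positivity), add_sub_cancel_right]
    exact hexp hy
  calc lambertKernel a y ≤ 1 / (1 + a * y) / (y / (1 + y)) := by
        rw [lambertKernel, neg_mul]
        gcongr
        exact hexp (mul_pos ha hy)
    _ = (1 + y) / (1 + a * y) / y := by field_simp
    _ ≤ (1 + 1 / a) / y := by
      gcongr
      rw [div_le_iff₀ (by positivity)]
      have : (1 + 1 / a) * (1 + a * y) = 1 + y + (a * y + 1 / a) := by field_simp; ring
      rw [this]
      exact le_add_of_nonneg_right (by positivity)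

theorem hasSum_dilationSum_lambertKernel (hN : N ≠ 0) (hx : 0 < x) {a : ℝ} (ha : 0 < a) :
    HasSum (fun n : ℕ => lambertKernel a (((n : ℝ) + 1) ^ N * x) / (n + 1))
      (dilationSum N x (lambertKernel a)) :=
  hasSum_dilationSum hN hx fun _ hy =>
    (abs_of_nonneg (lambertKernel_nonneg a hy)).trans_le (lambertKernel_le ha hy)

theorem abs_poissonKernel_le {y : ℝ} (hy : 0 < y) (t : ℝ) : |poissonKernel y t| ≤ 2 / y := by
  rw [abs_of_nonneg (poissonKernel_nonneg hy.le t), poissonKernel,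
    div_le_div_iff₀ (by positivity) hy]
  nlinarith [sq_nonneg (π * t)]

theorem hasSum_dilationSum_poissonKernel (hN : N ≠ 0) (hx : 0 < x) (t : ℝ) :
    HasSum (fun n : ℕ => poissonKernel (((n : ℝ) + 1) ^ N * x) t / (n + 1))
      (dilationSum N x (poissonKernel · t)) :=
  hasSum_dilationSum hN hx fun _ hy => abs_poissonKernel_le hy t

/-- The amount by which the dilation sum of the Poisson kernel at `t` exceeds its leading term
`1 / (2 N t)`. -/
def kernelDefect (N : ℕ) (x t : ℝ) : ℝ :=
  dilationSum N x (poissonKernel · t) - 1 / (2 * N * t)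

theorem kernelDefect_eq (h : ℕ) (hx : 0 < x) {t : ℝ} (ht : 0 < t) :
    (kernelDefect (2 * h + 1) x t : ℂ) =
      (-1) ^ h / ((2 * h + 1 : ℕ) * t) * dualSum (2 * h + 1) (2 * π * t / x) -
        if h = 0 then (x / (4 * π ^ 2 * t ^ 2) : ℂ) else 0 := by
  have hT : 0 < 2 * π * t / x := by positivity
  have hx0 : (x : ℂ) ≠ 0 := by exact_mod_cast hx.ne'
  have ht0 : (t : ℂ) ≠ 0 := by exact_mod_cast ht.ne'
  have hπ : (π : ℂ) ≠ 0 := by exact_mod_cast Real.pi_ne_zero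
  have hsum := (hasSum_pow_div_pow_add_sq h hT).mul_left (2 / x : ℂ)
  have hterm (n : ℕ) : (2 / x : ℂ) * (((n : ℂ) + 1) ^ (2 * h) /
      (((n : ℂ) + 1) ^ (2 * (2 * h + 1)) + (2 * π * t / x : ℝ) ^ 2)) =
      ((poissonKernel (((n : ℝ) + 1) ^ (2 * h + 1) * x) t / (n + 1) : ℝ) : ℂ) := by
    have key : 2 / x * (((n : ℝ) + 1) ^ (2 * h) /
        (((n : ℝ) + 1) ^ (2 * (2 * h + 1)) + (2 * π * t / x) ^ 2)) =
        poissonKernel (((n : ℝ) + 1) ^ (2 * h + 1) * x) t / (n + 1) := by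
      rw [poissonKernel]
      field_simp
      ring
    rw [← key]
    push_cast
    rfl
  simp_rw [hterm] at hsum
  rw [kernelDefect, Complex.ofReal_sub,
    (Complex.hasSum_ofReal.mpr (hasSum_dilationSum_poissonKernel (by lia) hx t)).unique hsum]
  have hN : ((2 * h + 1 : ℕ) : ℂ) ≠ 0 := Nat.cast_ne_zero.mpr (by lia)
  push_cast at hN ⊢
  rw [mul_sub]
  split_ifs
  · field_simp
    ring
  · field_simp
    ring

theorem norm_natCast_add_one (m : ℕ) : ‖(m : ℂ) + 1‖ = m + 1 := by
  exact_mod_cast Complex.norm_natCast (m + 1)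

theorem summable_div_mul_dualSum {c : ℕ → ℂ} (hc : ∀ m, ‖c m‖ ≤ 1) (hN : N ≠ 0) (hx : 0 < x) :
    Summable fun m : ℕ => c m / ((m : ℂ) + 1) * dualSum N (2 * π * (m + 1) / x) := by
  obtain ⟨C, hC⟩ := exists_norm_dualSum_le N
  have hp : 1 < 1 + 1 / (N : ℝ) :=
    lt_add_of_pos_right _ (one_div_pos.mpr (Nat.cast_pos.mpr (Nat.pos_of_ne_zero hN)))
  have hsum := (summable_nat_add_iff 1).mpr (Real.summable_one_div_nat_rpow.mpr hp)
  refine .of_norm_bounded (hsum.mul_left (C * (2 * π / x) ^ (-(1 / (N : ℝ))))) fun m => ?_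
  have hm : (0 : ℝ) < m + 1 := by positivity
  rw [norm_mul, norm_div, norm_natCast_add_one]
  push_cast
  calc _ ≤ 1 / ((m : ℝ) + 1) * (C * (2 * π * (m + 1) / x) ^ (-(1 / (N : ℝ)))) := by
        gcongr
        exacts [hc m, hC _ (by positivity)]
    _ = _ := by
      rw [mul_div_right_comm, Real.mul_rpow (by positivity) hm.le, Real.rpow_neg hm.le,
        Real.rpow_add hm, Real.rpow_one]
      field_simp

theorem hasSum_mul_kernelDefect {c : ℕ → ℂ} (hc : ∀ m, ‖c m‖ ≤ 1) (h : ℕ) (hx : 0 < x) :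
    HasSum (fun m : ℕ => c m * (kernelDefect (2 * h + 1) x (m + 1) : ℂ))
      ((-1) ^ h / (2 * h + 1 : ℕ) *
          ∑' m : ℕ, c m / ((m : ℂ) + 1) * dualSum (2 * h + 1) (2 * π * (m + 1) / x) -
        (if h = 0 then (x / (4 * π ^ 2) : ℂ) else 0) * ∑' m : ℕ, c m / ((m : ℂ) + 1) ^ 2) := by
  have hsq : Summable fun m : ℕ => c m / ((m : ℂ) + 1) ^ 2 := by
    refine .of_norm_bounded (summable_one_div_add_one_pow_succ one_ne_zero) fun m => ?_
    rw [norm_div, norm_pow, norm_natCast_add_one]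
    gcongr
    exact hc m
  refine (((summable_div_mul_dualSum hc (by lia) hx).hasSum.mul_left _).sub
    (hsq.hasSum.mul_left _)).congr_fun fun m => ?_
  rw [kernelDefect_eq h hx (by positivity)]
  push_cast
  split_ifs
  · field_simp
  · field_simp
    ring

theorem summable_kernelDefect (hN : Odd N) (hx : 0 < x) :
    Summable fun m : ℕ => kernelDefect N x (m + 1) := by
  obtain ⟨h, rfl⟩ := hN
  have hsum := hasSum_mul_kernelDefect (c := fun _ => 1) (fun _ => norm_one.le) h hx
  simp only [one_mul] at hsum
  exact Complex.summable_ofReal.mp hsum.summable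

end DilationSum

section LambertCosine

variable {N : ℕ} {x a : ℝ}

theorem hasSum_dilationSum_sum_poissonKernel_mul (hN : N ≠ 0) (hx : 0 < x) (c : ℕ → ℝ) (M : ℕ) :
    HasSum (fun n : ℕ =>
      (∑ m ∈ Finset.range M, poissonKernel (((n : ℝ) + 1) ^ N * x) (m + 1) * c m) / (n + 1))
      (1 / (2 * N) * ∑ m ∈ Finset.range M, c m / (m + 1) +
        ∑ m ∈ Finset.range M, kernelDefect N x (m + 1) * c m) := by
  have hsum := hasSum_sum fun m (_ : m ∈ Finset.range M) =>
    (hasSum_dilationSum_poissonKernel hN hx (m + 1)).mul_right (c m)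
  simp_rw [Finset.sum_div, mul_div_right_comm]
  convert! hsum using 1
  rw [Finset.mul_sum, ← Finset.sum_add_distrib]
  refine Finset.sum_congr rfl fun m _ => ?_
  rw [kernelDefect]
  field_simp
  ring

theorem abs_sum_poissonKernel_mul_cos_le (ha : a ∈ Set.Ioo (0 : ℝ) 1) (M : ℕ) {y : ℝ}
    (hy : 0 < y) :
    |∑ m ∈ Finset.range M, poissonKernel y (m + 1) * (2 * Real.cos (2 * π * (m + 1) * a))| ≤
      4 / Real.sin (π * a) / y := by
  have hanti : Antitone fun m : ℕ => poissonKernel y (m + 1) := fun m n hmn =>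
    antitoneOn_poissonKernel hy (Set.mem_Ici.mpr (by positivity))
      (Set.mem_Ici.mpr (by positivity)) (by gcongr)
  have hcos (n : ℕ) : ‖∑ m ∈ Finset.range n, 2 * Real.cos (2 * π * (m + 1) * a)‖ ≤
      2 * (1 / Real.sin (π * a)) := by
    rw [← Finset.mul_sum, norm_mul, Real.norm_ofNat]
    gcongr
    exact abs_sum_cos_le ha n
  have hsin := sin_pi_mul_pos ha
  calc _ ≤ poissonKernel y ((0 : ℕ) + 1) * (2 * (1 / Real.sin (π * a))) :=
        norm_sum_smul_le_of_antitone hanti (fun _ => poissonKernel_nonneg hy.le _) hcos M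
    _ ≤ 2 / y * (2 * (1 / Real.sin (π * a))) := by
      gcongr
      exact (le_abs_self _).trans (abs_poissonKernel_le hy _)
    _ = 4 / Real.sin (π * a) / y := by
      field_simp
      norm_num

theorem dilationSum_lambertKernel_add (hN : Odd N) (hx : 0 < x)
    (ha : a ∈ Set.Ioo (0 : ℝ) 1) :
    dilationSum N x (lambertKernel a) + dilationSum N x (lambertKernel (1 - a)) =
      2 * dilationSum N x (fun y => 1 / y) - 1 / N * Real.log (2 * Real.sin (π * a)) +
        2 * ∑' m : ℕ, Real.cos (2 * π * (m + 1) * a) * kernelDefect N x (m + 1) := by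
  have hN0 : N ≠ 0 := hN.pos.ne'
  have hdefect : Summable fun m : ℕ => kernelDefect N x (m + 1) *
      (2 * Real.cos (2 * π * (m + 1) * a)) := by
    refine .of_norm_bounded ((summable_kernelDefect hN hx).norm.mul_right 2) fun m => ?_
    rw [norm_mul, norm_mul, Real.norm_ofNat]
    gcongr
    exact mul_le_of_le_one_right zero_le_two (Real.abs_cos_le_one _)
  have hlim := tendsto_dilationSum hN0 hx (abs_sum_poissonKernel_mul_cos_le ha) fun y hy =>
    (hasSum_poissonKernel_mul_cos hy (Set.Ioo_subset_Ico_self ha)).tendsto_sum_nat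
  have hleft : dilationSum N x (fun y => lambertKernel a y + lambertKernel (1 - a) y - 2 / y) =
      dilationSum N x (lambertKernel a) + dilationSum N x (lambertKernel (1 - a)) -
        2 * dilationSum N x (fun y => 1 / y) := by
    rw [← (((hasSum_dilationSum_lambertKernel hN0 hx ha.1).add
      (hasSum_dilationSum_lambertKernel hN0 hx (sub_pos.mpr ha.2))).sub
      ((hasSum_dilationSum_one_div hN0 hx).mul_left 2)).tsum_eq]
    exact tsum_congr fun n => by ring
  have hright := (((tendsto_sum_cos_div ha).const_mul 2).const_mul (1 / (2 * N : ℝ))).add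
    hdefect.hasSum.tendsto_sum_nat
  have heq := tendsto_nhds_unique hlim (hright.congr fun M => by
    rw [dilationSum, (hasSum_dilationSum_sum_poissonKernel_mul hN0 hx _ M).tsum_eq, Finset.mul_sum]
    simp_rw [mul_div_assoc])
  rw [hleft, sub_eq_iff_eq_add] at heq
  rw [heq, ← tsum_mul_left]
  simp_rw [mul_comm (kernelDefect N x _), mul_assoc]
  ring

end LambertCosine

section Arctan

open MeasureTheory Set

theorem tendsto_harmonic_floor_sub_log :
    Tendsto (fun v : ℝ => (harmonic ⌊v⌋₊ : ℝ) - Real.log v) atTop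
      (𝓝 Real.eulerMascheroniConstant) := by
  have hratio : Tendsto (fun v : ℝ => Real.log (⌊v⌋₊ / v)) atTop (𝓝 0) := by
    simpa using tendsto_nat_floor_div_atTop.log one_ne_zero
  have hfloor := (Real.tendsto_harmonic_sub_log.comp (tendsto_nat_floor_atTop (α := ℝ))).add hratio
  rw [add_zero] at hfloor
  refine hfloor.congr' ?_
  filter_upwards [eventually_ge_atTop 1] with v hv
  have : (⌊v⌋₊ : ℝ) ≠ 0 := Nat.cast_ne_zero.mpr (Nat.floor_pos.mpr hv).ne'
  simp only [Function.comp_apply]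
  rw [Real.log_div this (by positivity)]
  ring

theorem abs_harmonic_floor_sub_log_le {v : ℝ} (hv : 0 ≤ v) :
    |(harmonic ⌊v⌋₊ : ℝ) - Real.log v| ≤ 1 + max 0 (-Real.log v) := by
  rcases lt_or_ge v 1 with hv1 | hv1
  · rw [Nat.floor_eq_zero.mpr hv1, harmonic_zero, Rat.cast_zero, zero_sub,
      abs_of_nonneg (neg_nonneg.mpr (Real.log_nonpos hv hv1.le))]
    exact (le_max_right _ _).trans (le_add_of_nonneg_left zero_le_one)
  · rw [abs_of_nonneg (sub_nonneg.mpr (log_le_harmonic_floor v hv)), sub_le_iff_le_add]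
    linarith [harmonic_floor_le_one_add_log v hv1, le_max_left 0 (-Real.log v)]

theorem integrableOn_log_tan :
    IntegrableOn (fun θ => Real.log (Real.tan θ)) (Ioo 0 (π / 2)) := by
  have hsub := (intervalIntegrable_log_sin (a := 0) (b := π / 2)).sub intervalIntegrable_log_cos
  rw [intervalIntegrable_iff_integrableOn_Ioo_of_le (by positivity)] at hsub
  refine hsub.congr_fun (fun θ hθ => ?_) measurableSet_Ioo
  have hsin := Real.sin_pos_of_pos_of_lt_pi hθ.1 (by linarith [hθ.2, Real.pi_pos])
  have hcos := Real.cos_pos_of_mem_Ioo ⟨by linarith [hθ.1, Real.pi_pos], hθ.2⟩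
  simp only [Function.comp_apply]
  rw [Real.tan_eq_sin_div_cos, Real.log_div hsin.ne' hcos.ne']

theorem integral_log_tan : ∫ θ in Ioo 0 (π / 2), Real.log (Real.tan θ) = 0 := by
  have hreflect := intervalIntegral.integral_comp_sub_left
    (fun θ => Real.log (Real.tan θ)) (π / 2) (a := 0) (b := π / 2)
  simp only [Real.tan_pi_div_two_sub, Real.log_inv, intervalIntegral.integral_neg, sub_self,
    sub_zero] at hreflect
  rw [← integral_Ioc_eq_integral_Ioo, ← intervalIntegral.integral_of_le (by positivity)]
  exact self_eq_neg.mp hreflect.symm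

variable {N : ℕ}

theorem le_arctan_div_pow_iff (hN : N ≠ 0) {T θ : ℝ} (hT : 0 < T)
    (hθ : θ ∈ Ioo 0 (π / 2)) (n : ℕ) :
    θ ≤ Real.arctan (T / (n + 1) ^ N) ↔ n < ⌊(T / Real.tan θ) ^ (1 / N : ℝ)⌋₊ := by
  have htan : 0 < Real.tan θ := Real.tan_pos_of_pos_of_lt_pi_div_two hθ.1 hθ.2
  have hN' : (0 : ℝ) < N := by positivity
  nth_rw 1 [← Real.arctan_tan (by linarith [hθ.1, Real.pi_pos]) hθ.2]
  rw [Real.arctan_le_arctan_iff, le_div_comm₀ htan (by positivity), Nat.lt_iff_add_one_le,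
    Nat.le_floor_iff (by positivity), one_div,
    Real.le_rpow_inv_iff_of_pos (by positivity) (by positivity) hN', Real.rpow_natCast]
  push_cast
  rfl

theorem hasSum_indicator_arctan (hN : N ≠ 0) {T θ : ℝ} (hT : 0 < T) (hθ : θ ∈ Ioo 0 (π / 2)) :
    HasSum (fun n : ℕ => (Iic (Real.arctan (T / (n + 1) ^ N))).indicator
      (fun _ => ((n : ℝ) + 1)⁻¹) θ) (harmonic ⌊(T / Real.tan θ) ^ (1 / N : ℝ)⌋₊) := by
  simp_rw [indicator_apply, mem_Iic, le_arctan_div_pow_iff hN hT hθ, ← Finset.mem_range, harmonic,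
    Rat.cast_sum]
  have hsupport := hasSum_sum_of_ne_finset_zero (L := .unconditional ℕ)
    (f := fun n =>
      if n ∈ Finset.range ⌊(T / Real.tan θ) ^ (1 / N : ℝ)⌋₊ then ((n : ℝ) + 1)⁻¹ else 0)
    fun n hn => if_neg hn
  rw [Finset.sum_congr rfl fun n hn => if_pos hn] at hsupport
  simpa using hsupport

theorem integral_indicator_arctan {T : ℝ} (hT : 0 ≤ T) (n : ℕ) :
    ∫ θ in Ioo 0 (π / 2), (Iic (Real.arctan (T / (n + 1) ^ N))).indicator
      (fun _ => ((n : ℝ) + 1)⁻¹) θ = Real.arctan (T / (n + 1) ^ N) / (n + 1) := by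
  have harctan : 0 ≤ Real.arctan (T / (n + 1) ^ N) := Real.arctan_nonneg.mpr (by positivity)
  have hinter : Ioo 0 (π / 2) ∩ Iic (Real.arctan (T / (n + 1) ^ N)) =
      Ioc 0 (Real.arctan (T / (n + 1) ^ N)) := by
    ext θ
    exact ⟨fun h => ⟨h.1.1, h.2⟩, fun h => ⟨⟨h.1, h.2.trans_lt (Real.arctan_lt_pi_div_two _)⟩, h.2⟩⟩
  rw [setIntegral_indicator measurableSet_Iic, hinter, setIntegral_const,
    Real.volume_real_Ioc_of_le harctan, sub_zero, smul_eq_mul]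
  exact (div_eq_mul_inv _ _).symm

theorem abs_arctan_le_abs (u : ℝ) : |Real.arctan u| ≤ |u| := by
  have hlip : LipschitzWith 1 Real.arctan :=
    lipschitzWith_of_nnnorm_deriv_le Real.differentiable_arctan fun u => by
      rw [Real.deriv_arctan, ← NNReal.coe_le_coe, coe_nnnorm, Real.norm_of_nonneg (by positivity)]
      exact div_le_one_of_le₀ (le_add_of_nonneg_right (sq_nonneg u)) (by positivity)
  simpa using hlip.norm_le_mul Real.arctan_zero u

theorem hasSum_dilationSum_arctan (hN : N ≠ 0) {x t : ℝ} (hx : 0 < x) (ht : 0 ≤ t) :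
    HasSum (fun n : ℕ => Real.arctan (t / (((n : ℝ) + 1) ^ N * x)) / (n + 1))
      (dilationSum N x fun y => Real.arctan (t / y)) :=
  hasSum_dilationSum hN hx fun y hy =>
    (abs_arctan_le_abs _).trans_eq (abs_of_nonneg (by positivity))

theorem hasSum_arctan_div_pow (hN : N ≠ 0) {T : ℝ} (hT : 0 < T) :
    HasSum (fun n : ℕ => Real.arctan (T / (n + 1) ^ N) / (n + 1))
      (∫ θ in Ioo 0 (π / 2), (harmonic ⌊(T / Real.tan θ) ^ (1 / N : ℝ)⌋₊ : ℝ)) := by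
  have hint := hasSum_integral_of_summable_integral_norm (μ := volume.restrict (Ioo 0 (π / 2)))
    (F := fun (n : ℕ) θ => (Iic (Real.arctan (T / (n + 1) ^ N))).indicator
      (fun _ => ((n : ℝ) + 1)⁻¹) θ)
    (fun n => (integrable_const _).indicator measurableSet_Iic) ?_
  · simp_rw [integral_indicator_arctan hT.le] at hint
    rwa [setIntegral_congr_fun measurableSet_Ioo
      fun θ hθ => (hasSum_indicator_arctan hN hT hθ).tsum_eq] at hint
  · refine (hasSum_dilationSum_arctan hN one_pos hT.le).summable.congr fun n => ?_
    rw [mul_one, ← integral_indicator_arctan hT.le]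
    refine integral_congr_ae (.of_forall fun θ => (Real.norm_of_nonneg ?_).symm)
    exact indicator_nonneg (fun _ _ => by positivity) θ

theorem log_div_tan_div (N : ℕ) {T θ : ℝ} (hT : 0 < T) (hθ : θ ∈ Ioo 0 (π / 2)) :
    Real.log (T / Real.tan θ) / N = Real.log ((T / Real.tan θ) ^ (1 / N : ℝ)) := by
  have := Real.tan_pos_of_pos_of_lt_pi_div_two hθ.1 hθ.2
  rw [Real.log_rpow (by positivity), one_div_mul_eq_div]

theorem abs_harmonic_floor_rpow_sub_log_le (hN : N ≠ 0) {T θ : ℝ} (hT : 1 ≤ T)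
    (hθ : θ ∈ Ioo 0 (π / 2)) :
    |(harmonic ⌊(T / Real.tan θ) ^ (1 / N : ℝ)⌋₊ : ℝ) - Real.log (T / Real.tan θ) / N| ≤
      1 + |Real.log (Real.tan θ)| := by
  have htan := Real.tan_pos_of_pos_of_lt_pi_div_two hθ.1 hθ.2
  have hN1 : (1 : ℝ) ≤ N := Nat.one_le_cast.mpr (Nat.one_le_iff_ne_zero.mpr hN)
  rw [log_div_tan_div N (by positivity) hθ]
  refine (abs_harmonic_floor_sub_log_le (by positivity)).trans ?_
  gcongr
  refine max_le (abs_nonneg _) ?_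
  rw [← log_div_tan_div N (by positivity) hθ, Real.log_div (by positivity) htan.ne', ← neg_div,
    neg_sub]
  calc (Real.log (Real.tan θ) - Real.log T) / N ≤ |Real.log (Real.tan θ)| / N := by
        gcongr
        exact (sub_le_self _ (Real.log_nonneg hT)).trans (le_abs_self _)
    _ ≤ |Real.log (Real.tan θ)| := div_le_self (abs_nonneg _) hN1

theorem measurable_harmonic_floor_sub_log (N : ℕ) (T : ℝ) :
    Measurable fun θ : ℝ =>
      (harmonic ⌊(T / Real.tan θ) ^ (1 / N : ℝ)⌋₊ : ℝ) - Real.log (T / Real.tan θ) / N := by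
  have htan : Measurable Real.tan :=
    funext Real.tan_eq_sin_div_cos ▸ Real.measurable_sin.div Real.measurable_cos
  have hharm : Measurable fun n : ℕ => (harmonic n : ℝ) := measurable_from_top
  exact (hharm.comp (Nat.measurable_floor.comp ((htan.const_div T).pow_const _))).sub
    ((Real.measurable_log.comp (htan.const_div T)).div_const _)

theorem integrableOn_harmonic_floor_sub_log (hN : N ≠ 0) {T : ℝ} (hT : 1 ≤ T) :
    IntegrableOn (fun θ : ℝ => (harmonic ⌊(T / Real.tan θ) ^ (1 / N : ℝ)⌋₊ : ℝ) -
      Real.log (T / Real.tan θ) / N) (Ioo 0 (π / 2)) :=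
  ((integrable_const 1).add integrableOn_log_tan.abs).mono'
    (measurable_harmonic_floor_sub_log N T).aestronglyMeasurable <| by
      filter_upwards [ae_restrict_mem measurableSet_Ioo] with θ hθ
      exact abs_harmonic_floor_rpow_sub_log_le hN hT hθ

theorem tendsto_integral_harmonic_sub_log (hN : N ≠ 0) :
    Tendsto (fun T : ℝ => ∫ θ in Ioo 0 (π / 2),
      ((harmonic ⌊(T / Real.tan θ) ^ (1 / N : ℝ)⌋₊ : ℝ) - Real.log (T / Real.tan θ) / N))
      atTop (𝓝 (π / 2 * Real.eulerMascheroniConstant)) := by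
  have hN' : (0 : ℝ) < 1 / N := one_div_pos.mpr (Nat.cast_pos.mpr (Nat.pos_of_ne_zero hN))
  have hconst : ∫ _ in Ioo 0 (π / 2), Real.eulerMascheroniConstant =
      π / 2 * Real.eulerMascheroniConstant := by
    rw [setIntegral_const, Real.volume_real_Ioo_of_le (by positivity), sub_zero, smul_eq_mul]
  rw [← hconst]
  refine tendsto_integral_filter_of_dominated_convergence
    (fun θ => 1 + |Real.log (Real.tan θ)|)
    (.of_forall fun T => (measurable_harmonic_floor_sub_log N T).aestronglyMeasurable) ?_
    ((integrable_const 1).add integrableOn_log_tan.abs) ?_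
  · filter_upwards [eventually_ge_atTop 1] with T hT
    filter_upwards [ae_restrict_mem measurableSet_Ioo] with θ hθ
    exact abs_harmonic_floor_rpow_sub_log_le hN hT hθ
  · filter_upwards [ae_restrict_mem measurableSet_Ioo] with θ hθ
    have htan := Real.tan_pos_of_pos_of_lt_pi_div_two hθ.1 hθ.2
    refine (tendsto_harmonic_floor_sub_log.comp
      ((tendsto_rpow_atTop hN').comp (tendsto_id.atTop_div_const htan))).congr' ?_
    filter_upwards [eventually_gt_atTop 0] with T hT
    simp only [Function.comp_apply, id_eq, log_div_tan_div N hT hθ]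

theorem tendsto_tsum_arctan_div_pow_sub_log (hN : N ≠ 0) :
    Tendsto (fun T : ℝ => ∑' n : ℕ, Real.arctan (T / (n + 1) ^ N) / (n + 1) -
      π / 2 * (Real.log T / N)) atTop (𝓝 (π / 2 * Real.eulerMascheroniConstant)) := by
  refine (tendsto_integral_harmonic_sub_log hN).congr' ?_
  filter_upwards [eventually_ge_atTop 1] with T hT
  have hlog : EqOn (fun θ => Real.log T / N - Real.log (Real.tan θ) / N)
      (fun θ => Real.log (T / Real.tan θ) / N) (Ioo 0 (π / 2)) := fun θ hθ => by
    have := Real.tan_pos_of_pos_of_lt_pi_div_two hθ.1 hθ.2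
    simp only
    rw [Real.log_div (by positivity) this.ne', sub_div]
  have hintegrable := (integrable_const (Real.log T / N)).sub (integrableOn_log_tan.div_const N)
  have hintegral : ∫ θ in Ioo 0 (π / 2), Real.log (T / Real.tan θ) / N =
      π / 2 * (Real.log T / N) := by
    rw [← setIntegral_congr_fun measurableSet_Ioo hlog,
      integral_sub (integrable_const _) (integrableOn_log_tan.div_const _),
      integral_div (N : ℝ) fun θ => Real.log (Real.tan θ), integral_log_tan, setIntegral_const,
      Real.volume_real_Ioo_of_le (by positivity), sub_zero, zero_div, sub_zero, smul_eq_mul]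
  have hlogint : IntegrableOn (fun θ => Real.log (T / Real.tan θ) / N) (Ioo 0 (π / 2)) :=
    IntegrableOn.congr_fun hintegrable hlog measurableSet_Ioo
  have hharm := ((integrableOn_harmonic_floor_sub_log hN hT).add hlogint).congr
    (.of_forall fun θ => sub_add_cancel _ _)
  rw [integral_sub hharm hlogint, hintegral, (hasSum_arctan_div_pow hN (by positivity)).tsum_eq]

end Arctan

section LambertZero

variable {N : ℕ} {x : ℝ}

theorem hasDerivAt_arctan_div_pi {y : ℝ} (hy : 0 < y) (t : ℝ) :
    HasDerivAt (fun t => Real.arctan (2 * π * t / y) / π) (poissonKernel y t) t := by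
  have hinner : HasDerivAt (fun t => 2 * π * t / y) (2 * π / y) t := by
    simpa using ((hasDerivAt_id t).const_mul (2 * π)).div_const y
  refine (hinner.arctan.div_const π).congr_deriv ?_
  rw [poissonKernel]
  field_simp
  ring

theorem integral_poissonKernel {y : ℝ} (hy : 0 < y) (T : ℝ) :
    ∫ t in (0 : ℝ)..T, poissonKernel y t = Real.arctan (2 * π * T / y) / π := by
  have hcont : Continuous (poissonKernel y) :=
    continuous_const.div (by fun_prop) fun t => by positivity
  rw [intervalIntegral.integral_eq_sub_of_hasDerivAt (fun t _ => hasDerivAt_arctan_div_pi hy t)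
    (hcont.intervalIntegrable 0 T)]
  simp

theorem abs_sum_poissonKernel_sub_arctan_le {y : ℝ} (hy : 0 < y) (M : ℕ) :
    |∑ m ∈ Finset.range M, poissonKernel y (m + 1) - Real.arctan (2 * π * M / y) / π| ≤
      2 / y := by
  have hanti : AntitoneOn (poissonKernel y) (Set.Icc 0 (0 + (M : ℝ))) :=
    (antitoneOn_poissonKernel hy).mono fun t ht => ht.1
  have hupper := hanti.sum_le_integral
  have hlower := hanti.integral_le_sum
  have hshift : ∑ m ∈ Finset.range M, poissonKernel y m + poissonKernel y M =
      ∑ m ∈ Finset.range M, poissonKernel y (m + 1) + 2 / y := by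
    rw [← Finset.sum_range_succ, Finset.sum_range_succ', Nat.cast_zero, poissonKernel_zero]
    push_cast
    rfl
  simp only [zero_add, integral_poissonKernel hy, Nat.cast_add_one] at hupper hlower
  have hnonneg := poissonKernel_nonneg hy.le M
  rw [abs_le]
  constructor
  · linarith
  · linarith [show 0 ≤ 2 / y by positivity]

theorem tendsto_sum_poissonKernel_sub_arctan {y : ℝ} (hy : 0 < y) :
    Tendsto (fun M : ℕ => ∑ m ∈ Finset.range M, poissonKernel y (m + 1) -
      Real.arctan (2 * π * M / y) / π) atTop (𝓝 (lambertKernel 1 y - 1 / y)) := by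
  have hsum := ((hasSum_poissonKernel_mul_cos hy
    (Set.left_mem_Ico.mpr one_pos)).div_const 2).tendsto_sum_nat
  have harctan : Tendsto (fun M : ℕ => Real.arctan (2 * π * M / y) / π) atTop (𝓝 (π / 2 / π)) :=
    .div_const ((tendsto_nhds_of_tendsto_nhdsWithin Real.tendsto_arctan_atTop).comp
      ((tendsto_natCast_atTop_atTop.const_mul_atTop (by positivity)).atTop_div_const hy)) π
  have hzero : lambertKernel 0 y = 1 + lambertKernel 1 y := by
    have := (one_sub_exp_neg_pos hy).ne'
    rw [lambertKernel, lambertKernel, neg_zero, zero_mul, Real.exp_zero, neg_one_mul]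
    field_simp
    ring
  convert! hsum.sub harctan using 2
  · simp
  · rw [sub_zero, hzero]
    field_simp
    ring

theorem dilationSum_sum_poissonKernel_sub_arctan (hN : N ≠ 0) (hx : 0 < x) (M : ℕ) :
    dilationSum N x (fun y => ∑ m ∈ Finset.range M, poissonKernel y (m + 1) -
      Real.arctan (2 * π * M / y) / π) =
      1 / (2 * N) * harmonic M + ∑ m ∈ Finset.range M, kernelDefect N x (m + 1) -
        (∑' n : ℕ, Real.arctan (2 * π * M / x / (n + 1) ^ N) / (n + 1)) / π := by
  have hpoisson := hasSum_dilationSum_sum_poissonKernel_mul hN hx (fun _ => 1) M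
  have harctan := (hasSum_dilationSum_arctan hN hx (t := 2 * π * M) (by positivity)).div_const π
  have hterm (n : ℕ) : 2 * π * M / x / ((n : ℝ) + 1) ^ N = 2 * π * M / ((n + 1) ^ N * x) := by
    rw [div_div, mul_comm x]
  have hharmonic : (harmonic M : ℝ) = ∑ m ∈ Finset.range M, 1 / ((m : ℝ) + 1) := by
    simp [harmonic]
  simp only [mul_one] at hpoisson
  simp_rw [hharmonic, hterm]
  refine Eq.trans (tsum_congr fun n => ?_) (hpoisson.sub harctan).tsum_eq
  rw [sub_div, div_right_comm]

theorem dilationSum_lambertKernel_one (hN : Odd N) (hx : 0 < x) :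
    dilationSum N x (lambertKernel 1) = dilationSum N x (fun y => 1 / y) +
      1 / (2 * N) * (Real.eulerMascheroniConstant * (1 - N) - Real.log (2 * π) + Real.log x) +
      ∑' m : ℕ, kernelDefect N x (m + 1) := by
  have hN0 : N ≠ 0 := hN.pos.ne'
  have hlim := tendsto_dilationSum hN0 hx
    (fun M y hy => abs_sum_poissonKernel_sub_arctan_le hy M)
    fun y hy => tendsto_sum_poissonKernel_sub_arctan hy
  have hleft : dilationSum N x (fun y => lambertKernel 1 y - 1 / y) =
      dilationSum N x (lambertKernel 1) - dilationSum N x (fun y => 1 / y) := by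
    rw [← ((hasSum_dilationSum_lambertKernel hN0 hx one_pos).sub
      (hasSum_dilationSum_one_div hN0 hx)).tsum_eq]
    exact tsum_congr fun n => sub_div _ _ _
  have hscale : Tendsto (fun M : ℕ => 2 * π * M / x) atTop atTop :=
    (tendsto_natCast_atTop_atTop.const_mul_atTop (by positivity)).atTop_div_const hx
  have hright := (((Real.tendsto_harmonic_sub_log.const_mul (1 / (2 * N : ℝ))).add
    (summable_kernelDefect hN hx).hasSum.tendsto_sum_nat).sub
    (((tendsto_tsum_arctan_div_pow_sub_log hN0).comp hscale).div_const π)).sub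
    (tendsto_const_nhds (x := (Real.log (2 * π) - Real.log x) / (2 * N)))
  simp_rw [dilationSum_sum_poissonKernel_sub_arctan hN0 hx] at hlim
  have heq := tendsto_nhds_unique hlim (hright.congr' ?_)
  · rw [hleft, sub_eq_iff_eq_add] at heq
    rw [heq]
    field_simp
    ring
  · filter_upwards [eventually_gt_atTop 0] with M hM
    have hM' : (0 : ℝ) < M := Nat.cast_pos.mpr hM
    simp only [Function.comp_apply]
    rw [Real.log_div (by positivity) hx.ne', Real.log_mul (by positivity) hM'.ne']
    field_simp
    ring

end LambertZero

section EvenCharacter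

variable {q : ℕ} {χ : DirichletCharacter ℂ q}

theorem sum_Icc_pred_mul_reflect (heven : χ.Even) (f : ℕ → ℂ) :
    ∑ r ∈ Finset.Icc 1 (q - 1), χ r * f (q - r) = ∑ r ∈ Finset.Icc 1 (q - 1), χ r * f r := by
  have hmaps {r : ℕ} (hr : r ∈ Finset.Icc 1 (q - 1)) :
      q - r ∈ Finset.Icc 1 (q - 1) ∧ r ≤ q := by
    rw [Finset.mem_Icc] at hr ⊢
    lia
  refine Finset.sum_nbij' (q - ·) (q - ·) (fun r hr => (hmaps hr).1) (fun r hr => (hmaps hr).1)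
    (fun r hr => Nat.sub_sub_self (hmaps hr).2) (fun r hr => Nat.sub_sub_self (hmaps hr).2)
    fun r hr => ?_
  rw [Nat.cast_sub (hmaps hr).2, ZMod.natCast_self, zero_sub, heven.eval_neg]

variable [NeZero q]

theorem sum_Icc_natCast_zmod {M : Type*} [AddCommMonoid M] (f : ZMod q → M) :
    ∑ r ∈ Finset.Icc 1 q, f r = ∑ j, f j := by
  refine Finset.sum_bij' (fun r _ => (r : ZMod q)) (fun j _ => if j = 0 then q else j.val)
    (fun _ _ => Finset.mem_univ _) (fun j _ => ?_) (fun r hr => ?_) (fun j _ => ?_) fun _ _ => rfl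
  · have hval := ZMod.val_lt j
    split_ifs with hj
    · exact Finset.mem_Icc.mpr ⟨NeZero.one_le, le_rfl⟩
    · exact Finset.mem_Icc.mpr ⟨Nat.one_le_iff_ne_zero.mpr ((ZMod.val_ne_zero j).mpr hj), hval.le⟩
  · obtain ⟨hr1, hrq⟩ := Finset.mem_Icc.mp hr
    rcases hrq.eq_or_lt with rfl | hlt
    · exact if_pos (ZMod.natCast_self r)
    · have : (r : ZMod q) ≠ 0 :=
        mt (ZMod.natCast_eq_zero_iff r q).mp (Nat.not_dvd_of_pos_of_lt hr1 hlt)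
      rw [if_neg this, ZMod.val_cast_of_lt hlt]
  · split_ifs with hj
    · rw [hj, ZMod.natCast_self]
    · exact ZMod.natCast_zmod_val j

theorem stdAddChar_natCast (n : ℕ) :
    ZMod.stdAddChar (n : ZMod q) = Complex.exp (2 * π * Complex.I * n / q) := by
  exact_mod_cast ZMod.stdAddChar_coe (N := q) n

theorem gauss_eq_gaussSum (χ : DirichletCharacter ℂ q) :
    gauss χ = gaussSum χ ZMod.stdAddChar := by
  rw [gaussSum, ← sum_Icc_natCast_zmod, gauss]
  simp_rw [stdAddChar_natCast]

theorem sum_mul_stdAddChar (hχ : χ.IsPrimitive) (k : ZMod q) :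
    ∑ j, χ j * ZMod.stdAddChar (k * j) = gauss χ * starRingEnd ℂ (χ k) := by
  have hshift := gaussSum_mulShift_of_isPrimitive (e := ZMod.stdAddChar) hχ k
  rw [← MulChar.star_eq_inv, MulChar.star_apply, mul_comm] at hshift
  rw [gauss_eq_gaussSum, starRingEnd_apply, ← hshift]
  rfl

theorem sum_mul_cos (hχ : χ.IsPrimitive) (heven : χ.Even) (m : ℕ) :
    ∑ r ∈ Finset.Icc 1 q, χ r * (Real.cos (2 * π * m * (r / q)) : ℂ) =
      gauss χ * starRingEnd ℂ (χ m) := by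
  have hcos (r : ℕ) : (Real.cos (2 * π * m * (r / q)) : ℂ) =
      (ZMod.stdAddChar ((m : ZMod q) * (r : ZMod q)) +
        ZMod.stdAddChar (-(m : ZMod q) * (r : ZMod q))) / 2 := by
    rw [neg_mul, AddChar.map_neg_eq_inv, ← Nat.cast_mul, stdAddChar_natCast, ← Complex.exp_neg,
      Complex.ofReal_cos, Complex.cos]
    push_cast
    ring_nf
  simp_rw [hcos]
  rw [sum_Icc_natCast_zmod fun j => χ j * ((ZMod.stdAddChar ((m : ZMod q) * j) +
    ZMod.stdAddChar (-(m : ZMod q) * j)) / 2)]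
  simp_rw [← mul_div_assoc, ← Finset.sum_div, mul_add, Finset.sum_add_distrib,
    sum_mul_stdAddChar hχ, heven.eval_neg, add_self_div_two]

theorem dft_eq_gauss_mul_conj (hχ : χ.IsPrimitive) (heven : χ.Even) (k : ZMod q) :
    ZMod.dft χ k = gauss χ * starRingEnd ℂ (χ k) := by
  rw [ZMod.dft_apply, ← heven.eval_neg, ← sum_mul_stdAddChar hχ]
  exact Finset.sum_congr rfl fun j _ => by rw [smul_eq_mul, neg_mul, mul_comm k, mul_comm]

theorem LFunction_neg_one (hχ : χ.IsPrimitive) (heven : χ.Even) :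
    DirichletCharacter.LFunction χ (-1) = -(q / (2 * π ^ 2)) *
      (gauss χ * ∑' m : ℕ, starRingEnd ℂ (χ (m + 1 : ℕ)) / ((m : ℂ) + 1) ^ 2) := by
  have hne (n : ℕ) : (2 : ℂ) ≠ -n := by
    rw [ne_eq, eq_neg_iff_add_eq_zero]
    exact_mod_cast Nat.succ_ne_zero (n + 1) ∘ (add_comm n 2).trans
  have hseries : ZMod.LFunction (ZMod.dft χ) 2 =
      gauss χ * ∑' m : ℕ, starRingEnd ℂ (χ (m + 1 : ℕ)) / ((m : ℂ) + 1) ^ 2 := by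
    rw [ZMod.LFunction_eq_LSeries _ (by norm_num), LSeries,
      (ZMod.LSeriesSummable_of_one_lt_re (ZMod.dft χ) (by norm_num)).tsum_eq_zero_add,
      LSeries.term_zero, zero_add, ← tsum_mul_left]
    refine tsum_congr fun m => ?_
    rw [LSeries.term_of_ne_zero m.succ_ne_zero, dft_eq_gauss_mul_conj hχ heven, Complex.cpow_ofNat,
      Nat.cast_succ (R := ℂ) m, mul_div_assoc]
  have hequation := ZMod.LFunction_one_sub χ hne (.inr (by norm_num))
  simp_rw [heven.eval_neg, hseries] at hequation
  have hcpow : (2 * π : ℂ) ^ (-2 : ℂ) = 1 / (4 * π ^ 2) := by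
    rw [Complex.cpow_neg, Complex.cpow_ofNat, mul_pow]
    norm_num
  rw [mul_div_cancel_right₀ _ two_ne_zero, mul_div_cancel_right₀ _ two_ne_zero, neg_mul,
    Complex.exp_neg, Complex.exp_pi_mul_I, hcpow, show (2 - 1 : ℂ) = 1 by norm_num,
    show (1 - 2 : ℂ) = -1 by norm_num, Complex.cpow_one,
    Complex.Gamma_ofNat_eq_factorial] at hequation
  rw [DirichletCharacter.LFunction, hequation]
  ring

end EvenCharacter

section LambertSeries

variable {q N : ℕ} {x : ℝ}

theorem norm_conj_apply_le_one (χ : DirichletCharacter ℂ q) (a : ZMod q) :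
    ‖starRingEnd ℂ (χ a)‖ ≤ 1 := by
  rw [RCLike.norm_conj]
  exact χ.norm_le_one a

theorem dualTerm_add_one (χ : DirichletCharacter ℂ q) (N : ℕ) (x : ℝ) (m : ℕ) :
    dualTerm χ N x (m + 1) = starRingEnd ℂ (χ (m + 1 : ℕ)) / ((m : ℂ) + 1) *
      dualSum N (2 * π * (m + 1) / x) := by
  rw [dualTerm_eq]
  push_cast
  rfl

theorem summable_dualTerm (χ : DirichletCharacter ℂ q) (hN : N ≠ 0) (hx : 0 < x) :
    Summable fun m : ℕ => dualTerm χ N x (m + 1) := by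
  simp_rw [dualTerm_add_one]
  exact summable_div_mul_dualSum (fun m => norm_conj_apply_le_one χ _) hN hx

theorem gauss_mul_tsum_kernelDefect [NeZero q] {χ : DirichletCharacter ℂ q} (hχ : χ.IsPrimitive)
    (heven : χ.Even) (hN : Odd N) (hx : 0 < x) :
    gauss χ * ∑' m : ℕ, starRingEnd ℂ (χ (m + 1 : ℕ)) * (kernelDefect N x (m + 1) : ℂ) =
      RN χ N x + K χ N x := by
  obtain ⟨h, rfl⟩ := hN
  have hdual : ∑' n : ℕ+, dualTerm χ (2 * h + 1) x n =
      ∑' m : ℕ, starRingEnd ℂ (χ (m + 1 : ℕ)) / ((m : ℂ) + 1) *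
        dualSum (2 * h + 1) (2 * π * (m + 1) / x) :=
    tsum_pnat_eq_tsum_succ.trans (tsum_congr fun m => dualTerm_add_one χ (2 * h + 1) x m)
  rw [(hasSum_mul_kernelDefect (fun m => norm_conj_apply_le_one χ _) h hx).tsum_eq, RN, K, hdual,
    show (2 * h + 1 + 3) / 2 = h + 2 by lia, LFunction_neg_one hχ heven, pow_add (-1 : ℂ) h 2,
    neg_one_sq, mul_one]
  rcases eq_or_ne h 0 with rfl | h0
  · have hq : (q : ℂ) ≠ 0 := NeZero.ne _
    rw [if_pos rfl, if_pos (by lia), mul_zero, zero_add, Nat.cast_one]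
    field_simp
    ring
  · rw [if_neg h0, if_neg (by lia)]
    ring

theorem sum_mul_tsum_cos_mul_kernelDefect [NeZero q] {χ : DirichletCharacter ℂ q}
    (hχ : χ.IsPrimitive) (heven : χ.Even) (hN : Odd N) (hx : 0 < x) :
    ∑ r ∈ Finset.Icc 1 q, χ r *
      ((∑' m : ℕ, Real.cos (2 * π * (m + 1) * (r / q)) * kernelDefect N x (m + 1) : ℝ) : ℂ) =
      RN χ N x + K χ N x := by
  have hcos (r : ℕ) : Summable fun m : ℕ =>
      Real.cos (2 * π * (m + 1) * (r / q)) * kernelDefect N x (m + 1) :=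
    .of_norm_bounded (summable_kernelDefect hN hx).norm fun _ =>
      (norm_mul_le _ _).trans (mul_le_of_le_one_left (norm_nonneg _) (Real.abs_cos_le_one _))
  rw [← gauss_mul_tsum_kernelDefect hχ heven hN hx, ← tsum_mul_left,
    ← (hasSum_sum fun r (_ : r ∈ Finset.Icc 1 q) =>
      (Complex.hasSum_ofReal.mpr (hcos r).hasSum).mul_left (χ r)).tsum_eq]
  refine tsum_congr fun m => ?_
  rw [← mul_assoc, ← sum_mul_cos hχ heven, Finset.sum_mul]
  push_cast
  simp_rw [mul_assoc]

theorem lambertTerm_add_one (χ : DirichletCharacter ℂ q) (N : ℕ) (x : ℝ) (r n : ℕ) :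
    lambertTerm χ N x r (n + 1) =
      χ r * ((lambertKernel (r / q) (((n : ℝ) + 1) ^ N * x) / (n + 1) : ℝ) : ℂ) := by
  rw [lambertTerm, lambertKernel, neg_mul (_ ^ N), mul_assoc (-_)]
  push_cast
  ring

theorem hasSum_lambertTerm (χ : DirichletCharacter ℂ q) (hN : N ≠ 0) (hx : 0 < x) {r : ℕ}
    (hr : r ∈ Finset.Icc 1 q) :
    HasSum (fun n : ℕ => lambertTerm χ N x r (n + 1))
      (χ r * (dilationSum N x (lambertKernel (r / q)) : ℂ)) := by
  simp_rw [lambertTerm_add_one]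
  obtain ⟨hr1, hrq⟩ := Finset.mem_Icc.mp hr
  have hrq : (0 : ℝ) < r / q :=
    div_pos (Nat.cast_pos.mpr hr1) (Nat.cast_pos.mpr (hr1.trans hrq))
  exact (Complex.hasSum_ofReal.mpr (hasSum_dilationSum_lambertKernel hN hx hrq)).mul_left _

theorem sum_tsum_lambertTerm (χ : DirichletCharacter ℂ q) (hN : N ≠ 0) (hx : 0 < x) :
    ∑ r ∈ Finset.Icc 1 q, ∑' n : ℕ+, lambertTerm χ N x r n =
      ∑ r ∈ Finset.Icc 1 q, χ r * (dilationSum N x (lambertKernel (r / q)) : ℂ) :=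
  Finset.sum_congr rfl fun r hr =>
    (tsum_pnat_eq_tsum_succ (f := lambertTerm χ N x r)).trans
      (hasSum_lambertTerm χ hN hx hr).tsum_eq

theorem sum_Icc_mul_eq_sum_Icc_pred (hq : 1 < q) (χ : DirichletCharacter ℂ q) (f : ℕ → ℂ) :
    ∑ r ∈ Finset.Icc 1 q, χ r * f r = ∑ r ∈ Finset.Icc 1 (q - 1), χ r * f r := by
  obtain ⟨k, rfl⟩ := Nat.exists_eq_add_of_lt hq
  rw [Finset.sum_Icc_succ_top (by lia), ZMod.natCast_self, χ.map_zero' hq.ne', zero_mul, add_zero,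
    Nat.add_sub_cancel]

theorem sum_Icc_pred_eq_zero (hq : 1 < q) {χ : DirichletCharacter ℂ q} (hχ : χ.IsPrimitive) :
    ∑ r ∈ Finset.Icc 1 (q - 1), χ r = 0 := by
  have : NeZero q := ⟨by lia⟩
  have hne : χ ≠ 1 := by
    rintro rfl
    rw [DirichletCharacter.isPrimitive_def, DirichletCharacter.conductor_one] at hχ
    exact hq.ne hχ
  have hpred := sum_Icc_mul_eq_sum_Icc_pred hq χ fun _ => 1
  simp only [mul_one] at hpred
  rw [← hpred, sum_Icc_natCast_zmod, MulChar.sum_eq_zero_of_ne_one hne]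

theorem dilationSum_lambertKernel_add_reflect (hN : Odd N) (hx : 0 < x) {r : ℕ}
    (hr : r ∈ Finset.Icc 1 (q - 1)) :
    dilationSum N x (lambertKernel (r / q)) + dilationSum N x (lambertKernel ((q - r : ℕ) / q)) =
      2 * dilationSum N x (fun y => 1 / y) - 1 / N * Real.log 2 -
        1 / N * Real.log (Real.sin (r * π / q)) +
        2 * ∑' m : ℕ, Real.cos (2 * π * (m + 1) * (r / q)) * kernelDefect N x (m + 1) := by
  obtain ⟨hr1, hrq⟩ := Finset.mem_Icc.mp hr
  have hr0 : (0 : ℝ) < r := Nat.cast_pos.mpr hr1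
  have hq0 : (r : ℝ) < q := Nat.cast_lt.mpr (by lia)
  have hrq' : (r / q : ℝ) ∈ Set.Ioo 0 1 :=
    ⟨div_pos hr0 (hr0.trans hq0), (div_lt_one (hr0.trans hq0)).mpr hq0⟩
  have hadd := dilationSum_lambertKernel_add hN hx hrq'
  rw [Real.log_mul two_ne_zero (sin_pi_mul_pos hrq').ne'] at hadd
  rw [Nat.cast_sub (by lia), sub_div, div_self (hr0.trans hq0).ne', hadd, mul_div_right_comm,
    mul_comm π]
  ring

theorem sum_dilationSum_lambertKernel_of_one_lt [NeZero q] (hq : 1 < q)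
    {χ : DirichletCharacter ℂ q} (hχ : χ.IsPrimitive) (heven : χ.Even) (hN : Odd N) (hx : 0 < x) :
    ∑ r ∈ Finset.Icc 1 q, χ r * (dilationSum N x (lambertKernel (r / q)) : ℂ) =
      R0 χ N x + (RN χ N x + K χ N x) := by
  set L : ℕ → ℂ := fun r => dilationSum N x (lambertKernel (r / q))
  have hpair : ∀ r ∈ Finset.Icc 1 (q - 1), χ r * L r + χ r * L (q - r) =
      (2 * dilationSum N x (fun y => 1 / y) - 1 / N * Real.log 2 : ℝ) * χ r -
        1 / N * (χ r * Real.log (Real.sin (r * π / q))) +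
        2 * (χ r * (∑' m : ℕ, Real.cos (2 * π * (m + 1) * (r / q)) *
          kernelDefect N x (m + 1) : ℝ)) := fun r hr => by
    rw [← mul_add, ← Complex.ofReal_add, dilationSum_lambertKernel_add_reflect hN hx hr]
    push_cast
    ring
  have htwo : 2 * ∑ r ∈ Finset.Icc 1 (q - 1), χ r * L r =
      -(1 / N) * ∑ r ∈ Finset.Icc 1 (q - 1), χ r * (Real.log (Real.sin (r * π / q)) : ℂ) +
        2 * (RN χ N x + K χ N x) := by
    nth_rw 1 [two_mul]
    nth_rw 2 [← sum_Icc_pred_mul_reflect heven]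
    rw [← Finset.sum_add_distrib, Finset.sum_congr rfl hpair, Finset.sum_add_distrib,
      Finset.sum_sub_distrib, ← Finset.mul_sum, ← Finset.mul_sum, ← Finset.mul_sum,
      sum_Icc_pred_eq_zero hq hχ, ← sum_mul_tsum_cos_mul_kernelDefect hχ heven hN hx,
      sum_Icc_mul_eq_sum_Icc_pred hq]
    ring
  rw [sum_Icc_mul_eq_sum_Icc_pred hq χ L, R0, if_neg hq.ne']
  linear_combination htwo / 2

theorem dilationSum_one_div (hN : N ≠ 0) (x : ℝ) :
    (dilationSum N x (fun y => 1 / y) : ℂ) = riemannZeta (N + 1) / x := by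
  have hzeta := zeta_nat_eq_tsum_of_gt_one (show 1 < N + 1 by lia)
  have hsummable : Summable fun n : ℕ => 1 / (n : ℂ) ^ (N + 1) :=
    (Complex.summable_ofReal.mpr (Real.summable_one_div_nat_pow.mpr
      (show 1 < N + 1 by lia))).congr fun n => by push_cast; rfl
  rw [hsummable.tsum_eq_zero_add, Nat.cast_zero, zero_pow N.succ_ne_zero, div_zero, zero_add,
    Nat.cast_succ] at hzeta
  rw [hzeta, dilationSum, Complex.ofReal_tsum, ← tsum_div_const]
  refine tsum_congr fun n => ?_
  push_cast
  rw [div_div, div_div, mul_right_comm, pow_succ]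

theorem sum_dilationSum_lambertKernel_of_eq_one {χ : DirichletCharacter ℂ 1}
    (hχ : χ.IsPrimitive) (heven : χ.Even) (hN : Odd N) (hx : 0 < x) :
    ∑ r ∈ Finset.Icc (1 : ℕ) 1, χ r * (dilationSum N x (lambertKernel (r / (1 : ℕ))) : ℂ) =
      R0 χ N x + R1 1 N x + (RN χ N x + K χ N x) := by
  have hdual := sum_mul_tsum_cos_mul_kernelDefect hχ heven hN hx
  have hcos (m : ℕ) : Real.cos (2 * π * (m + 1)) = 1 := by
    have := Real.cos_nat_mul_two_pi (m + 1)
    rwa [mul_comm, Nat.cast_succ] at this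
  simp only [Finset.Icc_self, Finset.sum_singleton, Nat.cast_one, map_one, div_one, mul_one,
    one_mul, hcos] at hdual ⊢
  rw [dilationSum_lambertKernel_one hN hx, R0, if_pos rfl, R1, if_pos rfl, ← hdual,
    ← dilationSum_one_div hN.pos.ne' x]
  push_cast
  ring

end LambertSeries

end LambertChar

end

theorem theorem2p5 (q : ℕ) [NeZero q] (χ : DirichletCharacter ℂ q) (hprim : χ.IsPrimitive)
    (heven : χ.Even) (N : ℕ) (hN : Odd N) (x : ℝ) (hx : 0 < x) :
    (∀ r ∈ Finset.Icc 1 q, Summable fun n : ℕ+ => LambertChar.lambertTerm χ N x r (n : ℕ)) ∧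
    (Summable fun n : ℕ+ => LambertChar.dualTerm χ N x (n : ℕ)) ∧
    ∑ r ∈ Finset.Icc 1 q, ∑' n : ℕ+, LambertChar.lambertTerm χ N x r (n : ℕ) =
      LambertChar.R0 χ N x + LambertChar.R1 q N x + LambertChar.RN χ N x
        + LambertChar.K χ N x := by
  refine ⟨fun r hr => summable_pnat_iff_summable_succ.mpr
      (LambertChar.hasSum_lambertTerm χ hN.pos.ne' hx hr).summable,
    summable_pnat_iff_summable_succ.mpr (LambertChar.summable_dualTerm χ hN.pos.ne' hx), ?_⟩
  rw [LambertChar.sum_tsum_lambertTerm χ hN.pos.ne' hx, add_assoc]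
  rcases (NeZero.one_le : 1 ≤ q).eq_or_lt with rfl | hq
  · exact LambertChar.sum_dilationSum_lambertKernel_of_eq_one hprim heven hN hx
  · rw [LambertChar.R1, if_neg hq.ne', add_zero]
    exact LambertChar.sum_dilationSum_lambertKernel_of_one_lt hq hprim heven hN hx
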